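/- Fix $h\in\mathbb C$ such that $q=e^h$ is not a root of unity, and write $q^x=e^{hx}$, $[x]=\frac{q^x-q^{-x}}{q-q^{-1}}$ for $x\in\mathbb C$, and $[n]!=[1][2]\cdots[n]$. Call $\lambda\in\mathbb C$ generic if $[2\lambda+m]\neq0$ for all $m\in\mathbb Z$. Let $U_q(\mathfrak{sl}_2)$ be generated by $E,F,K^{\pm1}$ with $KE=qEK$, $KF=q^{-1}FK$, $EF-FE=\frac{K^2-K^{-2}}{q-q^{-1}}$, with coproduct $\Delta E=E\otimes K+K^{-1}\otimes E$, $\Delta F=F\otimes K+K^{-1}\otimes F$, $\Delta K=K\otimes K$. The Verma module $M_\lambda$ has basis $e^\lambda_{\lambda-k}$, $k\in\mathbb Z_{\ge0}$, with $$Ke^\lambda_a=q^ae^\lambda_a,\qquad Ee^\lambda_{\lambda-k}=[k]\,e^\lambda_{\lambda-k+1},\qquad Fe^\lambda_{\lambda-k}=[2\lambda-k]\,e^\lambda_{\lambda-k-1}.$$ For generic $\lambda_1,\lambda_2,\lambda$ with $n=\lambda_1+\lambda_2-\lambda\in\mathbb Z_{\ge0}$ let $\psi^{\lambda}_{\lambda_1\lambda_2}:M_\lambda\to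 M_{\lambda_1}\otimes M_{\lambda_2}$ be the module embedding with $$\psi^\lambda_{\lambda_1\lambda_2}(e^\lambda_\lambda)=\Delta(\lambda_1,\lambda_2,\lambda)\sum_{i=0}^n\frac{(-1)^i\,q^{\frac12(\lambda_2(\lambda_2+1)-\lambda_1(\lambda_1+1)-\lambda(\lambda+1))+(\lambda_1-i)(\lambda+1)}}{[i]!\,[n-i]!}\;e^{\lambda_1}_{\lambda_1-i}\otimes e^{\lambda_2}_{\lambda_2-(n-i)},$$ where $\Delta(\lambda_1,\lambda_2,\lambda)$ is an arbitrary, once and for all fixed, choice of square root of $$[n]!\prod_{j=0}^{n-1}\frac{[2\lambda_1-j]\,[2\lambda_2-j]}{[2\lambda+2+j]}.$$ In $M_{\lambda_1}\otimes M_{\lambda_2}\otimes M_{\lambda_3}$ put $e^{\lambda_{12},\lambda}_a=(\psi^{\lambda_{12}}_{\lambda_1\lambda_2}\otimes\mathrm{id})\,\psi^{\lambda}_{\lambda_{12}\lambda_3}(e^\lambda_a)$ and $e^{\lambda_{23},\lambda}_a=(\mathrm{id}\otimes\psi^{\lambda_{23}}_{\lambda_2\lambda_3})\,\psi^{\lambda}_{\lambda_1\lambda_{23}}(e^\lambda_a)$.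 The $q6j$-symbols are the coefficients in $$e^{\lambda_{12},\lambda}_a=\sum_{\lambda_{23}}\begin{Bmatrix}\lambda_1&\lambda_2&\lambda_{12}\\ \lambda_3&\lambda&\lambda_{23}\end{Bmatrix}_q e^{\lambda_{23},\lambda}_a\qquad\text{for all } a,$$ the sum being over $\lambda_{23}=\lambda_2+\lambda_3-m$, $0\le m\le\lambda_1+\lambda_2+\lambda_3-\lambda$. **Theorem (Biedenharn–Elliott, or pentagon, identity).** Let $\lambda_1,\lambda_2,\lambda_3,\lambda_4,\lambda_{12},\lambda_2+\lambda_3,\lambda_{34},\lambda_{123},\lambda_{234},\lambda_{1234}$ be generic, and let $\lambda_1+\lambda_2-\lambda_{12}$, $\lambda_3+\lambda_4-\lambda_{34}$, $\lambda_{12}+\lambda_3-\lambda_{123}$, $\lambda_2+\lambda_{34}-\lambda_{234}$, $\lambda_{123}+\lambda_4-\lambda_{1234}$, $\lambda_1+\lambda_{234}-\lambda_{1234}$, $\lambda_{12}+\lambda_{34}-\lambda_{1234}$ be non-negative integers. Then the expansions defining all the symbols below exist and are unique, and $$\sum_{\alpha}\begin{Bmatrix}\lambda_1&\lambda_2&\lambda_{12}\\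 \lambda_3&\lambda_{123}&\alpha\end{Bmatrix}_q\begin{Bmatrix}\lambda_1&\alpha&\lambda_{123}\\ \lambda_4&\lambda_{1234}&\lambda_{234}\end{Bmatrix}_q\begin{Bmatrix}\lambda_2&\lambda_3&\alpha\\ \lambda_4&\lambda_{234}&\lambda_{34}\end{Bmatrix}_q=\begin{Bmatrix}\lambda_{12}&\lambda_3&\lambda_{123}\\ \lambda_4&\lambda_{1234}&\lambda_{34}\end{Bmatrix}_q\begin{Bmatrix}\lambda_1&\lambda_2&\lambda_{12}\\ \lambda_{34}&\lambda_{1234}&\lambda_{234}\end{Bmatrix}_q,$$ where $\alpha=\lambda_2+\lambda_3-j$ with $j=0,1,\dots,\min\{\lambda_2+\lambda_3+\lambda_4-\lambda_{234},\ \lambda_1+\lambda_2+\lambda_3-\lambda_{123}\}$. -/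

import Mathlib

open scoped TensorProduct

noncomputable section

namespace VermaSixJ

/-- The complex power `q ^ x = exp (h x)` of the deformation parameter `q = exp h`. -/
def qpow (h x : ℂ) : ℂ := Complex.exp (h * x)

/-- The `q`-number `[x] = (q ^ x - q ^ (-x)) / (q - q⁻¹)`. -/
def qnum (h x : ℂ) : ℂ := (qpow h x - qpow h (-x)) / (qpow h 1 - qpow h (-1))

/-- The `q`-factorial `[n]! = [1] [2] ⋯ [n]`. -/
def qfact (h : ℂ) (n : ℕ) : ℂ := ∏ j ∈ Finset.range n, qnum h (j + 1)

/-- `q = exp h` is not a root of unity. -/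
def NotRootOfUnity (h : ℂ) : Prop := ∀ n : ℕ, 0 < n → qpow h n ≠ 1

/-- A weight `lam` is generic if `[2 lam + m] ≠ 0` for all integers `m`. -/
def Generic (h lam : ℂ) : Prop := ∀ m : ℤ, qnum h (2 * lam + m) ≠ 0

/-- `z` is a nonnegative integer. -/
def IsNat (z : ℂ) : Prop := ∃ n : ℕ, z = n

/-- The natural number `n` when `z = n` is a nonnegative integer. -/
def toN (z : ℂ) : ℕ := ⌊z.re⌋₊

theorem toN_natCast (n : ℕ) : toN (n : ℂ) = n := by
  simp [toN]

theorem qpow_add (h x y : ℂ) : qpow h (x + y) = qpow h x * qpow h y := by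
  rw [qpow, mul_add, Complex.exp_add]; rfl

theorem qpow_neg_mul (h x : ℂ) : qpow h (-x) * qpow h x = 1 := by
  rw [← qpow_add]; simp [qpow]

/-- A module `V` over `U_q(sl₂)`, given by the action of the generators `E`, `F`, `K`, `K⁻¹`
subject to the defining relations (here `K` stands for `q ^ (H / 2)`). -/
structure UqModule (h : ℂ) (V : Type*) [AddCommGroup V] [Module ℂ V] where
  E : Module.End ℂ V
  F : Module.End ℂ V
  K : Module.End ℂ V
  K' : Module.End ℂ V
  mul_K' : K * K' = 1
  K'_mul : K' * K = 1
  K_E : K * E = qpow h 1 • (E * K)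
  K_F : K * F = qpow h (-1) • (F * K)
  E_F : (qpow h 1 - qpow h (-1)) • (E * F - F * E) = K * K - K' * K'

/-- The space underlying every Verma module. In `M_lam` the basis vector `single k 1` is the
weight vector `e_a` of weight `a = lam - k`. -/
abbrev VermaSpace : Type := ℕ →₀ ℂ

/-- The basis vector `e_{lam - k}` of `M_lam`. -/
def vec (k : ℕ) : VermaSpace := Finsupp.single k 1

/-- `E e_{lam - k} = [k] e_{lam - k + 1}`. -/
def vermaE (h : ℂ) : Module.End ℂ VermaSpace :=
  Finsupp.linearCombination ℂ fun k : ℕ => qnum h k • vec (k - 1)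

/-- `F e_{lam - k} = [2 lam - k] e_{lam - k - 1}`. -/
def vermaF (h lam : ℂ) : Module.End ℂ VermaSpace :=
  Finsupp.linearCombination ℂ fun k : ℕ => qnum h (2 * lam - k) • vec (k + 1)

/-- `K e_a = q ^ a e_a`. -/
def vermaK (h lam : ℂ) : Module.End ℂ VermaSpace :=
  Finsupp.linearCombination ℂ fun k : ℕ => qpow h (lam - k) • vec k

/-- `K⁻¹ e_a = q ^ (-a) e_a`. -/
def vermaK' (h lam : ℂ) : Module.End ℂ VermaSpace :=
  Finsupp.linearCombination ℂ fun k : ℕ => qpow h (-(lam - k)) • vec k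

theorem vermaE_vec (h : ℂ) (k : ℕ) : vermaE h (vec k) = qnum h k • vec (k - 1) := by
  simp [vermaE, vec]

theorem vermaF_vec (h lam : ℂ) (k : ℕ) :
    vermaF h lam (vec k) = qnum h (2 * lam - k) • vec (k + 1) := by
  simp [vermaF, vec]

theorem vermaK_vec (h lam : ℂ) (k : ℕ) : vermaK h lam (vec k) = qpow h (lam - k) • vec k := by
  simp [vermaK, vec]

theorem vermaK'_vec (h lam : ℂ) (k : ℕ) :
    vermaK' h lam (vec k) = qpow h (-(lam - k)) • vec k := by
  simp [vermaK', vec]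

theorem end_ext {f g : Module.End ℂ VermaSpace} (H : ∀ k, f (vec k) = g (vec k)) : f = g :=
  Finsupp.lhom_ext' fun k => LinearMap.ext_ring (H k)

theorem qnum_zero (h : ℂ) : qnum h 0 = 0 := by simp [qnum]

theorem qnum_comm (h lam x : ℂ) (hq : qpow h 1 - qpow h (-1) ≠ 0) :
    (qpow h 1 - qpow h (-1)) *
      (qnum h (2 * lam - x) * qnum h (x + 1) - qnum h x * qnum h (2 * lam - x + 1)) =
    qpow h (lam - x) * qpow h (lam - x) - qpow h (-(lam - x)) * qpow h (-(lam - x)) := by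
  have e1 := qpow_neg_mul h x
  have e2 := qpow_neg_mul h lam
  have e3 := qpow_neg_mul h 1
  have a1 : qpow h (2 * lam - x) = qpow h lam * qpow h lam * qpow h (-x) := by
    rw [← qpow_add, ← qpow_add]; ring_nf
  have a2 : qpow h (-(2 * lam - x)) = qpow h (-lam) * qpow h (-lam) * qpow h x := by
    rw [← qpow_add, ← qpow_add]; ring_nf
  have a3 : qpow h (2 * lam - x + 1) = qpow h lam * qpow h lam * qpow h (-x) * qpow h 1 := by
    rw [qpow_add, a1]
  have a4 : qpow h (-(2 * lam - x + 1)) =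
      qpow h (-lam) * qpow h (-lam) * qpow h x * qpow h (-1) := by
    rw [neg_add, qpow_add, a2]
  have a5 : qpow h (x + 1) = qpow h x * qpow h 1 := qpow_add _ _ _
  have a6 : qpow h (-(x + 1)) = qpow h (-x) * qpow h (-1) := by rw [neg_add, qpow_add]
  have a7 : qpow h (lam - x) = qpow h lam * qpow h (-x) := by rw [sub_eq_add_neg, qpow_add]
  have a8 : qpow h (-(lam - x)) = qpow h (-lam) * qpow h x := by
    rw [← qpow_add]; ring_nf
  simp only [qnum, a1, a2, a3, a4, a5, a6, a7, a8]
  field_simp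
  generalize qpow h x = X at *
  generalize qpow h (-x) = X' at *
  generalize qpow h lam = L at *
  generalize qpow h (-lam) = L' at *
  generalize qpow h 1 = Q at *
  generalize qpow h (-1) = Q' at *
  ring

/-- The Verma module `M_lam` of highest weight `lam`. -/
def verma (h : ℂ) (hq : NotRootOfUnity h) (lam : ℂ) : UqModule h VermaSpace where
  E := vermaE h
  F := vermaF h lam
  K := vermaK h lam
  K' := vermaK' h lam
  mul_K' := by
    refine end_ext fun k => ?_
    simp only [Module.End.mul_apply, vermaK'_vec, vermaK_vec, map_smul, smul_smul, qpow_neg_mul,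
      one_smul, Module.End.one_apply]
  K'_mul := by
    refine end_ext fun k => ?_
    simp only [Module.End.mul_apply, vermaK'_vec, vermaK_vec, map_smul, smul_smul,
      mul_comm (qpow h (lam - _)), qpow_neg_mul, one_smul, Module.End.one_apply]
  K_E := by
    refine end_ext fun k => ?_
    simp only [Module.End.mul_apply, LinearMap.smul_apply, vermaE_vec, vermaK_vec, map_smul,
      smul_smul]
    rcases k with _ | k
    · simp [qnum_zero]
    · congr 1
      have : lam - ((k + 1 - 1 : ℕ) : ℂ) = 1 + (lam - ((k + 1 : ℕ) : ℂ)) := by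
        push_cast [Nat.add_sub_cancel]; ring
      rw [this, qpow_add]; ring
  K_F := by
    refine end_ext fun k => ?_
    simp only [Module.End.mul_apply, LinearMap.smul_apply, vermaF_vec, vermaK_vec, map_smul,
      smul_smul]
    congr 1
    have : lam - ((k + 1 : ℕ) : ℂ) = -1 + (lam - (k : ℂ)) := by push_cast; ring
    rw [this, qpow_add]; ring
  E_F := by
    have hq' : qpow h 1 - qpow h (-1) ≠ 0 := by
      intro H
      apply hq 2 two_pos
      have e := qpow_neg_mul h 1
      have e' : qpow h ((2 : ℕ) : ℂ) = qpow h 1 * qpow h 1 := by rw [← qpow_add]; norm_num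
      rw [← sub_eq_zero.mp H] at e
      rw [e', e]
    refine end_ext fun k => ?_
    simp only [Module.End.mul_apply, LinearMap.smul_apply, LinearMap.sub_apply, vermaE_vec,
      vermaF_vec, vermaK_vec, vermaK'_vec, map_smul, smul_smul]
    rw [← sub_smul, ← qnum_comm h lam k hq', mul_smul, sub_smul]
    rcases k with _ | k
    · simp [qnum_zero]
      module
    · simp only [Nat.add_sub_cancel]
      have e1 : ((k + 1 + 1 : ℕ) : ℂ) = ((k + 1 : ℕ) : ℂ) + 1 := by push_cast; ring
      have e2 : 2 * lam - (k : ℂ) = 2 * lam - ((k + 1 : ℕ) : ℂ) + 1 := by push_cast; ring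
      rw [e1, e2]
      module

section Tensor

variable {h : ℂ} {V W : Type*} [AddCommGroup V] [Module ℂ V] [AddCommGroup W] [Module ℂ W]

/-- The tensor product of two modules, formed with the coproduct
`Δ E = E ⊗ K + K⁻¹ ⊗ E`, `Δ F = F ⊗ K + K⁻¹ ⊗ F`, `Δ K = K ⊗ K`. -/
def UqModule.tensor (A : UqModule h V) (B : UqModule h W) : UqModule h (V ⊗[ℂ] W) where
  E := TensorProduct.map A.E B.K + TensorProduct.map A.K' B.E
  F := TensorProduct.map A.F B.K + TensorProduct.map A.K' B.F
  K := TensorProduct.map A.K B.K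
  K' := TensorProduct.map A.K' B.K'
  mul_K' := by
    rw [← TensorProduct.map_mul, A.mul_K', B.mul_K', TensorProduct.map_one]
  K'_mul := by
    rw [← TensorProduct.map_mul, A.K'_mul, B.K'_mul, TensorProduct.map_one]
  K_E := by
    rw [mul_add, add_mul, smul_add]
    simp only [← TensorProduct.map_mul]
    rw [A.K_E, B.K_E, A.mul_K', A.K'_mul, TensorProduct.map_smul_left,
      TensorProduct.map_smul_right]
  K_F := by
    rw [mul_add, add_mul, smul_add]
    simp only [← TensorProduct.map_mul]
    rw [A.K_F, B.K_F, A.mul_K', A.K'_mul, TensorProduct.map_smul_left,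
      TensorProduct.map_smul_right]
  E_F := by
    have aE : A.E * A.K' = qpow h 1 • (A.K' * A.E) := by
      have := congrArg (fun x => A.K' * x * A.K') A.K_E
      simp only [mul_smul_comm, smul_mul_assoc] at this
      rw [← mul_assoc A.K', A.K'_mul, one_mul, mul_assoc A.K', mul_assoc A.E, A.mul_K',
        mul_one] at this
      exact this
    have aF : A.F * A.K' = qpow h (-1) • (A.K' * A.F) := by
      have := congrArg (fun x => A.K' * x * A.K') A.K_F
      simp only [mul_smul_comm, smul_mul_assoc] at this
      rw [← mul_assoc A.K', A.K'_mul, one_mul, mul_assoc A.K', mul_assoc A.F, A.mul_K',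
        mul_one] at this
      exact this
    have key : (TensorProduct.map A.E B.K + TensorProduct.map A.K' B.E) *
          (TensorProduct.map A.F B.K + TensorProduct.map A.K' B.F) -
        (TensorProduct.map A.F B.K + TensorProduct.map A.K' B.F) *
          (TensorProduct.map A.E B.K + TensorProduct.map A.K' B.E) =
        TensorProduct.map (A.E * A.F - A.F * A.E) (B.K * B.K) +
          TensorProduct.map (A.K' * A.K') (B.E * B.F - B.F * B.E) := by
      simp only [mul_add, add_mul, ← TensorProduct.map_mul]
      rw [aE, aF, B.K_E, B.K_F]
      simp only [TensorProduct.map_smul_left, TensorProduct.map_smul_right, smul_smul,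
        sub_eq_add_neg, TensorProduct.map_add_left, TensorProduct.map_add_right]
      rw [mul_comm (qpow h 1), qpow_neg_mul]
      simp only [← neg_one_smul ℂ (A.F * A.E), ← neg_one_smul ℂ (B.F * B.E),
        TensorProduct.map_smul_left, TensorProduct.map_smul_right]
      module
    rw [key, smul_add, ← TensorProduct.map_smul_left, ← TensorProduct.map_smul_right, A.E_F,
      B.E_F]
    simp only [← TensorProduct.map_mul, sub_eq_add_neg, TensorProduct.map_add_left,
      TensorProduct.map_add_right]
    simp only [← neg_one_smul ℂ (A.K' * A.K'), ← neg_one_smul ℂ (B.K' * B.K'),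
      TensorProduct.map_smul_left, TensorProduct.map_smul_right]
    rw [← neg_one_smul ℂ (TensorProduct.map _ _)]
    module

end Tensor

/-- The quantity `Δ(lam₁, lam₂, lam)²`, where with `n = lam₁ + lam₂ - lam`
`Δ² = [n]! ∏ [2 lam₁ - j] ∏ [2 lam₂ - j] / ∏ [2 lam + 2 + j]`, products over `0 ≤ j < n`. -/
def deltaSq (h l1 l2 l : ℂ) : ℂ :=
  qfact h (toN (l1 + l2 - l)) *
    (∏ j ∈ Finset.range (toN (l1 + l2 - l)), qnum h (2 * l1 - j)) *
    (∏ j ∈ Finset.range (toN (l1 + l2 - l)), qnum h (2 * l2 - j)) /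
    ∏ j ∈ Finset.range (toN (l1 + l2 - l)), qnum h (2 * l + 2 + j)

/-- `D` is a choice of the square roots `Δ(lam₁, lam₂, lam)`, for all triples with
`lam₁ + lam₂ - lam` a nonnegative integer. -/
def IsDelta (h : ℂ) (D : ℂ → ℂ → ℂ → ℂ) : Prop :=
  ∀ l1 l2 l : ℂ, IsNat (l1 + l2 - l) → D l1 l2 l ^ 2 = deltaSq h l1 l2 l

variable (h : ℂ) (hq : NotRootOfUnity h) (D : ℂ → ℂ → ℂ → ℂ)

/-- The normalized highest weight vector of weight `l` in `M_{l1} ⊗ M_{l2}`; its coefficient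
at `e_{a₁} ⊗ e_{a₂}`, where `a₁ = l1 - i`, `a₂ = l2 - (n - i)` and `n = l1 + l2 - l`, is the
`q3j`-symbol at `a = l`. -/
def hwVec (l1 l2 l : ℂ) : VermaSpace ⊗[ℂ] VermaSpace :=
  ∑ i ∈ Finset.range (toN (l1 + l2 - l) + 1),
    (D l1 l2 l * (-1) ^ i *
      qpow h ((l2 * (l2 + 1) - l1 * (l1 + 1) - l * (l + 1)) / 2 + (l1 - i) * (l + 1)) /
      (qfact h i * qfact h (toN (l1 + l2 - l) - i))) •
    (vec i ⊗ₜ[ℂ] vec (toN (l1 + l2 - l) - i))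

/-- The embedding `ψ : M_l → M_{l1} ⊗ M_{l2}` of modules that sends the highest weight vector
of `M_l` to `hwVec`. Since `e_{l-k} = F ^ k e_l / ∏_{j < k} [2 l - j]` in `M_l`, it sends
`e_{l-k}` to `F ^ k hwVec / ∏_{j < k} [2 l - j]`. Its matrix elements are the `q3j`-symbols. -/
def psi (l1 l2 l : ℂ) : VermaSpace →ₗ[ℂ] VermaSpace ⊗[ℂ] VermaSpace :=
  Finsupp.linearCombination ℂ fun k : ℕ =>
    (∏ j ∈ Finset.range k, qnum h (2 * l - j))⁻¹ •
      (((verma h hq l1).tensor (verma h hq l2)).F ^ k) (hwVec h D l1 l2 l)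

/-- The vector `e^{l12,l}_{l-k}` of `(M_{l1} ⊗ M_{l2}) ⊗ M_{l3}`, obtained from the embeddings
`M_l → M_{l12} ⊗ M_{l3} → (M_{l1} ⊗ M_{l2}) ⊗ M_{l3}`. -/
def leftVec (l1 l2 l12 l3 l : ℂ) (k : ℕ) : (VermaSpace ⊗[ℂ] VermaSpace) ⊗[ℂ] VermaSpace :=
  TensorProduct.map (psi h hq D l1 l2 l12) LinearMap.id (psi h hq D l12 l3 l (vec k))

/-- The vector `e^{l23,l}_{l-k}`, obtained from the embeddings
`M_l → M_{l1} ⊗ M_{l23} → M_{l1} ⊗ (M_{l2} ⊗ M_{l3})` and rebracketing. -/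
def rightVec (l1 l2 l3 l23 l : ℂ) (k : ℕ) : (VermaSpace ⊗[ℂ] VermaSpace) ⊗[ℂ] VermaSpace :=
  (TensorProduct.assoc ℂ VermaSpace VermaSpace VermaSpace).symm
    (TensorProduct.map LinearMap.id (psi h hq D l2 l3 l23) (psi h hq D l1 l23 l (vec k)))

/-- The numbers `c m` are the coefficients, at `l23 = l2 + l3 - m`, of the expansion of the
vectors `e^{l12,l}_a` in the vectors `e^{l23,l}_a`, for all `a = l - k`. Here
`0 ≤ m ≤ l1 + l2 + l3 - l`, and `c m = 0` by convention for all other `m`. -/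
def IsRecoupling (l1 l2 l12 l3 l : ℂ) (c : ℕ → ℂ) : Prop :=
  (∀ m : ℕ, toN (l1 + l2 + l3 - l) < m → c m = 0) ∧
  ∀ k : ℕ, leftVec h hq D l1 l2 l12 l3 l k =
    ∑ m ∈ Finset.range (toN (l1 + l2 + l3 - l) + 1),
      c m • rightVec h hq D l1 l2 l3 (l2 + l3 - m) l k

/-- The expansion that defines the `q6j`-symbols exists and is unique. -/
def HasRecoupling (l1 l2 l12 l3 l : ℂ) : Prop :=
  ∃! c : ℕ → ℂ, IsRecoupling h hq D l1 l2 l12 l3 l c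

open Classical in
/-- The `q6j`-symbol with upper row `l1, l2, l12` and lower row `l3, l, l23`: the matrix element
of the change between the vectors `e^{l12,l}_a` and `e^{l23,l}_a`. -/
def q6j (l1 l2 l12 l3 l l23 : ℂ) : ℂ :=
  if H : ∃ c : ℕ → ℂ, IsRecoupling h hq D l1 l2 l12 l3 l c then
    H.choose (toN (l2 + l3 - l23))
  else 0

end VermaSixJ

end

open VermaSixJ

/-! The pentagon compares two expansions of one embedding of `M_l1234` into the fourfold tensor
product, the one that couples 1 with 2, then with 3, then with 4. Recoupling (12)3 to 1(23) and then
(1(23))4 to 1((23)4) gives the products on the left side. Recoupling ((12)3)4 to (12)(34) and then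
(12)(34) to 1(2(34)) gives those on the right. Both expansions have the form `∑ₖ (id ⊗ fₖ) ψₖ`, with
`ψₖ` the embedding into `M_l1 ⊗ M_(l2+l3+l4-k)` and `fₖ` a homomorphism from `M_(l2+l3+l4-k)` to the
product of factors 2, 3, 4.

The homomorphisms `fₖ` are determined by that sum (`hom_eq_zero_of_sum_map_psi`). The component
along the highest weight vector of `M_l1` turns `ψₖ` of the highest weight vector into a nonzero
multiple of a single basis vector, and powers of E then isolate the `fₖ` one after another. At
`l234` the two `fₖ` thus agree. One is a combination of left maps, the other of right maps;
expanding the former by a third recoupling and comparing coefficients gives the identity.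

Recoupling coefficients are unique by the same argument. They exist because a singular vector is
determined by its component along the highest weight vector of the first factor, and a dimension
count shows that the images of the `psi` span the relevant weight space of the other two factors. Of
the square roots Δ only their nonvanishing matters. -/

namespace VermaSixJ

/-! ### Nonvanishing of q-numbers at generic weights -/

section QNumbers

variable {h : ℂ}

theorem qpow_ne_zero (h x : ℂ) : qpow h x ≠ 0 := Complex.exp_ne_zero _

theorem qpow_sub_ne_zero_of_sq {x : ℂ} (hx : qpow h (2 * x) ≠ 1) :
    qpow h x - qpow h (-x) ≠ 0 := by
  intro H
  apply hx
  have e := qpow_neg_mul h x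
  rw [← sub_eq_zero.mp H] at e
  rw [two_mul, qpow_add, e]

theorem NotRootOfUnity.sub_ne_zero (hq : NotRootOfUnity h) (n : ℕ) :
    qpow h (n + 1) - qpow h (-(n + 1)) ≠ 0 := by
  refine qpow_sub_ne_zero_of_sq ?_
  have := hq (2 * (n + 1)) (by positivity)
  push_cast at this
  exact this

theorem NotRootOfUnity.q_sub_ne_zero (hq : NotRootOfUnity h) :
    qpow h 1 - qpow h (-1) ≠ 0 := by
  simpa using hq.sub_ne_zero 0

theorem NotRootOfUnity.qnum_ne_zero (hq : NotRootOfUnity h) (n : ℕ) : qnum h (n + 1) ≠ 0 :=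
  div_ne_zero (hq.sub_ne_zero n) hq.q_sub_ne_zero

theorem NotRootOfUnity.qfact_ne_zero (hq : NotRootOfUnity h) (n : ℕ) : qfact h n ≠ 0 :=
  Finset.prod_ne_zero_iff.mpr fun j _ => hq.qnum_ne_zero j

/-- K separates weights that differ by integers; this is what bounds the weight spaces of a tensor
product. -/
theorem NotRootOfUnity.qpow_sub_natCast_inj (hq : NotRootOfUnity h) {c : ℂ} {m n : ℕ}
    (H : qpow h (c - m) = qpow h (c - n)) : m = n := by
  wlog hmn : m ≤ n generalizing m n
  · exact (this H.symm (le_of_not_ge hmn)).symm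
  obtain ⟨k, rfl⟩ := Nat.exists_eq_add_of_le hmn
  rcases Nat.eq_zero_or_pos k with rfl | hk
  · rfl
  · refine absurd ?_ (hq k hk)
    have e : c - m = (c - (m + k : ℕ)) + k := by push_cast; ring
    rw [e, qpow_add] at H
    exact mul_left_cancel₀ (qpow_ne_zero _ _) (H.trans (mul_one _).symm)

theorem Generic.sub_natCast {l : ℂ} (hl : Generic h l) (n : ℕ) : Generic h (l - n) := by
  intro m
  have := hl (m - 2 * n)
  push_cast at this
  convert this using 2
  ring

theorem Generic.add_natCast {l : ℂ} (hl : Generic h l) (n : ℕ) : Generic h (l + n) := by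
  intro m
  have := hl (m + 2 * n)
  push_cast at this
  convert this using 2
  ring

theorem Generic.qnum_sub_ne_zero {l : ℂ} (hl : Generic h l) (n : ℕ) :
    qnum h (2 * l - n) ≠ 0 := by
  simpa [sub_eq_add_neg] using hl (-n)

theorem Generic.prod_ne_zero {l : ℂ} (hl : Generic h l) (n : ℕ) :
    ∏ j ∈ Finset.range n, qnum h (2 * l - j) ≠ 0 :=
  Finset.prod_ne_zero_iff.mpr fun j _ => hl.qnum_sub_ne_zero j

theorem deltaSq_ne_zero (hq : NotRootOfUnity h) {l1 l2 l : ℂ} (g1 : Generic h l1)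
    (g2 : Generic h l2) (g : Generic h l) : deltaSq h l1 l2 l ≠ 0 := by
  refine div_ne_zero (mul_ne_zero (mul_ne_zero (hq.qfact_ne_zero _) (g1.prod_ne_zero _))
    (g2.prod_ne_zero _)) (Finset.prod_ne_zero_iff.mpr fun j _ => ?_)
  have := g (2 + j)
  push_cast at this
  rwa [← add_assoc] at this

/-- All that the argument needs from the chosen square roots: no compatibility between their signs
enters. -/
theorem IsDelta.ne_zero {D : ℂ → ℂ → ℂ → ℂ} (hD : IsDelta h D) (hq : NotRootOfUnity h)
    {l1 l2 l : ℂ} (g1 : Generic h l1) (g2 : Generic h l2) (g : Generic h l)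
    (hn : IsNat (l1 + l2 - l)) : D l1 l2 l ≠ 0 := by
  intro H
  have := hD l1 l2 l hn
  rw [H, zero_pow two_ne_zero] at this
  exact deltaSq_ne_zero hq g1 g2 g this.symm

end QNumbers

/-! ### Homomorphisms of modules and their tensor products -/

section Hom

variable {h : ℂ} {U V W X : Type*} [AddCommGroup U] [Module ℂ U] [AddCommGroup V] [Module ℂ V]
  [AddCommGroup W] [Module ℂ W] [AddCommGroup X] [Module ℂ X]

/-- A linear map that commutes with the action of `U_q(sl₂)`. -/
structure UqModule.IsHom (A : UqModule h V) (B : UqModule h W) (f : V →ₗ[ℂ] W) : Prop where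
  E : ∀ x, f (A.E x) = B.E (f x)
  F : ∀ x, f (A.F x) = B.F (f x)
  K : ∀ x, f (A.K x) = B.K (f x)

namespace UqModule

theorem K'_K (A : UqModule h V) (x : V) : A.K' (A.K x) = x := by
  rw [← Module.End.mul_apply, A.K'_mul, Module.End.one_apply]

theorem K_K' (A : UqModule h V) (x : V) : A.K (A.K' x) = x := by
  rw [← Module.End.mul_apply, A.mul_K', Module.End.one_apply]

theorem E_F_apply (A : UqModule h V) (x : V) :
    (qpow h 1 - qpow h (-1)) • A.E (A.F x) =
      (qpow h 1 - qpow h (-1)) • A.F (A.E x) + (A.K (A.K x) - A.K' (A.K' x)) := by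
  have := LinearMap.congr_fun A.E_F x
  simp only [LinearMap.smul_apply, LinearMap.sub_apply, Module.End.mul_apply, smul_sub] at this
  rw [← this]
  abel

theorem tensor_E_tmul (A : UqModule h V) (B : UqModule h W) (x : V) (y : W) :
    (A.tensor B).E (x ⊗ₜ y) = A.E x ⊗ₜ B.K y + A.K' x ⊗ₜ B.E y := rfl

theorem tensor_F_tmul (A : UqModule h V) (B : UqModule h W) (x : V) (y : W) :
    (A.tensor B).F (x ⊗ₜ y) = A.F x ⊗ₜ B.K y + A.K' x ⊗ₜ B.F y := rfl

theorem tensor_K_tmul (A : UqModule h V) (B : UqModule h W) (x : V) (y : W) :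
    (A.tensor B).K (x ⊗ₜ y) = A.K x ⊗ₜ B.K y := rfl

theorem tensor_K'_tmul (A : UqModule h V) (B : UqModule h W) (x : V) (y : W) :
    (A.tensor B).K' (x ⊗ₜ y) = A.K' x ⊗ₜ B.K' y := rfl

namespace IsHom

variable {A : UqModule h V} {B : UqModule h W} {C : UqModule h X}

theorem K' {f : V →ₗ[ℂ] W} (hf : A.IsHom B f) (x : V) : f (A.K' x) = B.K' (f x) := by
  conv_rhs => rw [← A.K_K' x, hf.K, B.K'_K]

theorem comp {f : V →ₗ[ℂ] W} {g : W →ₗ[ℂ] X} (hg : B.IsHom C g) (hf : A.IsHom B f) :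
    A.IsHom C (g ∘ₗ f) where
  E x := by simp [hf.E, hg.E]
  F x := by simp [hf.F, hg.F]
  K x := by simp [hf.K, hg.K]

theorem id (A : UqModule h V) : A.IsHom A LinearMap.id where
  E _ := rfl
  F _ := rfl
  K _ := rfl

theorem zero (A : UqModule h V) (B : UqModule h W) : A.IsHom B 0 where
  E x := by simp
  F x := by simp
  K x := by simp

theorem add {f g : V →ₗ[ℂ] W} (hf : A.IsHom B f) (hg : A.IsHom B g) : A.IsHom B (f + g) where
  E x := by simp [hf.E, hg.E]
  F x := by simp [hf.F, hg.F]
  K x := by simp [hf.K, hg.K]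

theorem smul {f : V →ₗ[ℂ] W} (hf : A.IsHom B f) (c : ℂ) : A.IsHom B (c • f) where
  E x := by simp [hf.E]
  F x := by simp [hf.F]
  K x := by simp [hf.K]

theorem sub {f g : V →ₗ[ℂ] W} (hf : A.IsHom B f) (hg : A.IsHom B g) : A.IsHom B (f - g) where
  E x := by simp [hf.E, hg.E]
  F x := by simp [hf.F, hg.F]
  K x := by simp [hf.K, hg.K]

theorem sum {ι : Type*} {s : Finset ι} {f : ι → V →ₗ[ℂ] W} (hf : ∀ i ∈ s, A.IsHom B (f i)) :
    A.IsHom B (∑ i ∈ s, f i) :=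
  Finset.sum_induction f (A.IsHom B) (fun _ _ => add) (zero A B) hf

theorem map {A' : UqModule h U} {f : V →ₗ[ℂ] W} {g : U →ₗ[ℂ] X} (hf : A.IsHom B f)
    (hg : A'.IsHom C g) : (A.tensor A').IsHom (B.tensor C) (TensorProduct.map f g) where
  E x := by
    induction x with
    | zero => simp
    | add x y hx hy => simp only [map_add, hx, hy]
    | tmul x y => simp [tensor_E_tmul, hf.E, hf.K', hg.E, hg.K]
  F x := by
    induction x with
    | zero => simp
    | add x y hx hy => simp only [map_add, hx, hy]
    | tmul x y => simp [tensor_F_tmul, hf.F, hf.K', hg.F, hg.K]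
  K x := by
    induction x with
    | zero => simp
    | add x y hx hy => simp only [map_add, hx, hy]
    | tmul x y => simp [tensor_K_tmul, hf.K, hg.K]

theorem E_pow {f : V →ₗ[ℂ] W} (hf : A.IsHom B f) (k : ℕ) (x : V) :
    f ((A.E ^ k) x) = (B.E ^ k) (f x) := by
  induction k generalizing x with
  | zero => rfl
  | succ k ih => rw [pow_succ, Module.End.mul_apply, ih, hf.E, ← Module.End.mul_apply, ← pow_succ]

end IsHom

/-- Coassociativity of the coproduct, checked on generators. -/
theorem isHom_assoc (A : UqModule h V) (B : UqModule h W) (C : UqModule h X) :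
    ((A.tensor B).tensor C).IsHom (A.tensor (B.tensor C))
      (TensorProduct.assoc ℂ V W X).toLinearMap where
  E x := by
    let α := (TensorProduct.assoc ℂ V W X).toLinearMap
    refine LinearMap.congr_fun (f := α ∘ₗ ((A.tensor B).tensor C).E)
      (g := (A.tensor (B.tensor C)).E ∘ₗ α) (TensorProduct.ext_threefold fun x y z => ?_) x
    simp [α, tensor_E_tmul, tensor_K_tmul, tensor_K'_tmul, TensorProduct.add_tmul,
      TensorProduct.tmul_add, add_assoc]
  F x := by
    let α := (TensorProduct.assoc ℂ V W X).toLinearMap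
    refine LinearMap.congr_fun (f := α ∘ₗ ((A.tensor B).tensor C).F)
      (g := (A.tensor (B.tensor C)).F ∘ₗ α) (TensorProduct.ext_threefold fun x y z => ?_) x
    simp [α, tensor_F_tmul, tensor_K_tmul, tensor_K'_tmul, TensorProduct.add_tmul,
      TensorProduct.tmul_add, add_assoc]
  K x := by
    let α := (TensorProduct.assoc ℂ V W X).toLinearMap
    refine LinearMap.congr_fun (f := α ∘ₗ ((A.tensor B).tensor C).K)
      (g := (A.tensor (B.tensor C)).K ∘ₗ α) (TensorProduct.ext_threefold fun x y z => ?_) x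
    simp [α, tensor_K_tmul]

end UqModule

end Hom

/-! ### Homomorphisms out of Verma modules, and singular vectors -/

section Verma

variable {h : ℂ} {hq : NotRootOfUnity h} {W : Type*} [AddCommGroup W] [Module ℂ W]

open UqModule

theorem vec_apply (k i : ℕ) : vec k i = if k = i then 1 else 0 := Finsupp.single_apply

theorem end_ext' {f g : VermaSpace →ₗ[ℂ] W} (H : ∀ k, f (vec k) = g (vec k)) : f = g :=
  Finsupp.lhom_ext' fun k => LinearMap.ext_ring (H k)

theorem vermaE_pow_vec_of_lt {j k : ℕ} (hjk : j < k) : (vermaE h ^ k) (vec j) = 0 := by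
  induction k generalizing j with
  | zero => omega
  | succ k ih =>
    rw [pow_succ, Module.End.mul_apply, vermaE_vec, map_smul]
    rcases j with _ | j
    · simp [qnum_zero]
    · rw [Nat.add_sub_cancel, ih (by omega), smul_zero]

theorem vermaE_pow_vec_self (h : ℂ) (k : ℕ) : (vermaE h ^ k) (vec k) = qfact h k • vec 0 := by
  induction k with
  | zero => simp [qfact]
  | succ k ih =>
    rw [pow_succ, Module.End.mul_apply, vermaE_vec, map_smul, Nat.add_sub_cancel, ih, smul_smul,
      qfact, qfact, Finset.prod_range_succ, mul_comm]
    push_cast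
    rfl

/-- A homomorphism from a generic Verma module is determined by its highest weight vector. -/
theorem hom_verma_eq_zero {B : UqModule h W} {l : ℂ} (hl : Generic h l)
    {f : VermaSpace →ₗ[ℂ] W} (hf : (verma h hq l).IsHom B f) (H : f (vec 0) = 0) : f = 0 := by
  refine end_ext' fun k => ?_
  induction k with
  | zero => simpa using H
  | succ k ih =>
    have := hf.F (vec k)
    rw [ih, show (verma h hq l).F = vermaF h l from rfl, vermaF_vec] at this
    simpa [hl.qnum_sub_ne_zero k] using this

/-- A highest weight vector of generic weight defines a homomorphism from a Verma module. -/
theorem isHom_linearCombination_of_highestWeight {B : UqModule h W} {l : ℂ} (hl : Generic h l)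
    {v : W} (hE : B.E v = 0) (hK : B.K v = qpow h l • v) :
    (verma h hq l).IsHom B (Finsupp.linearCombination ℂ fun k : ℕ =>
      (∏ j ∈ Finset.range k, qnum h (2 * l - j))⁻¹ • (B.F ^ k) v) := by
  set f : VermaSpace →ₗ[ℂ] W := Finsupp.linearCombination ℂ fun k : ℕ =>
      (∏ j ∈ Finset.range k, qnum h (2 * l - j))⁻¹ • (B.F ^ k) v with hf
  have fv : ∀ k, f (vec k) = (∏ j ∈ Finset.range k, qnum h (2 * l - j))⁻¹ • (B.F ^ k) v := by
    intro k; simp [hf, vec]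
  have eE : (verma h hq l).E = vermaE h := rfl
  have eF : (verma h hq l).F = vermaF h l := rfl
  have eK : (verma h hq l).K = vermaK h l := rfl
  have F : ∀ x, f ((verma h hq l).F x) = B.F (f x) := by
    intro x
    refine LinearMap.congr_fun (f := f ∘ₗ _) (g := B.F ∘ₗ f) (end_ext' fun k => ?_) x
    have := hl.qnum_sub_ne_zero k
    simp only [LinearMap.comp_apply, eF, vermaF_vec, map_smul, fv, smul_smul,
      Finset.prod_range_succ, pow_succ', Module.End.mul_apply]
    congr 1
    field_simp
  -- By genericity F reaches every basis vector from the highest one, so compatibility with K and E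
  -- propagates by induction along F.
  have Fvec : ∀ k, vec (k + 1) = (qnum h (2 * l - k))⁻¹ • (verma h hq l).F (vec k) := by
    intro k
    rw [eF, vermaF_vec, smul_smul, inv_mul_cancel₀ (hl.qnum_sub_ne_zero k), one_smul]
  have K : ∀ x, f ((verma h hq l).K x) = B.K (f x) := by
    intro x
    refine LinearMap.congr_fun (f := f ∘ₗ _) (g := B.K ∘ₗ f) (end_ext' fun k => ?_) x
    simp only [LinearMap.comp_apply]
    induction k with
    | zero => simp [eK, vermaK_vec, fv, hK]
    | succ k ih =>
      have e1 := LinearMap.congr_fun (verma h hq l).K_F (vec k)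
      have e2 := LinearMap.congr_fun B.K_F (f (vec k))
      simp only [LinearMap.smul_apply, Module.End.mul_apply] at e1 e2
      rw [Fvec, map_smul, map_smul, map_smul, map_smul, e1, map_smul, F, ih, F, e2]
  have K' : ∀ x, f ((verma h hq l).K' x) = B.K' (f x) := by
    intro x
    conv_rhs => rw [← (verma h hq l).K_K' x, K, B.K'_K]
  refine ⟨fun x => ?_, F, K⟩
  refine LinearMap.congr_fun (f := f ∘ₗ _) (g := B.E ∘ₗ f) (end_ext' fun k => ?_) x
  simp only [LinearMap.comp_apply]
  induction k with
  | zero => simp [eE, vermaE_vec, fv, hE, qnum_zero]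
  | succ k ih =>
    rw [Fvec, map_smul, map_smul, map_smul, map_smul, F]
    congr 1
    -- The factor q - q⁻¹ is restored because the relation between E and F is stated without
    -- denominators.
    refine smul_right_injective W hq.q_sub_ne_zero ?_
    simp only
    rw [B.E_F_apply, ← ih, ← map_smul, (verma h hq l).E_F_apply]
    simp only [map_add, map_sub, map_smul, F, K, K']

/-- The vectors `vec (n - m)` of the modules `M_(ν-m)` all have weight ν - n, but need different
powers of E to reach the top. Applying `E ^ (n - m)` kills the terms of index above m and sends the
m-th to `[n-m]!` times the image of the highest weight vector; the terms of smaller index vanish by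
induction. -/
theorem hom_eq_zero_of_sum_eq_zero {B : UqModule h W} {ν : ℂ} (hν : Generic h ν) {n : ℕ}
    {f : ℕ → VermaSpace →ₗ[ℂ] W} (hf : ∀ m ≤ n, (verma h hq (ν - m)).IsHom B (f m))
    (H : ∑ m ∈ Finset.range (n + 1), f m (vec (n - m)) = 0) : ∀ m ≤ n, f m = 0 := by
  intro m
  induction m using Nat.strong_induction_on with
  | _ m ih =>
    intro hm
    refine hom_verma_eq_zero (hν.sub_natCast m) (hf m hm) ?_
    have H' := congrArg (B.E ^ (n - m)) H
    rw [map_sum, map_zero, Finset.sum_eq_single m] at H'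
    · rw [← (hf m hm).E_pow, show (verma h hq (ν - m)).E = vermaE h from rfl,
        vermaE_pow_vec_self, map_smul] at H'
      exact (smul_eq_zero.mp H').resolve_left (hq.qfact_ne_zero _)
    · intro k hk hkm
      have hk : k ≤ n := Nat.lt_succ_iff.mp (Finset.mem_range.mp hk)
      rcases lt_or_gt_of_ne hkm with hlt | hgt
      · simp [ih k hlt hk]
      · rw [← (hf k hk).E_pow, show (verma h hq (ν - k)).E = vermaE h from rfl,
          vermaE_pow_vec_of_lt (by omega), map_zero]
    · intro hm'
      exact absurd (Finset.mem_range.mpr (Nat.lt_succ_of_le hm)) hm'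

/-- The component of a tensor along the `i`-th basis vector of the first factor. -/
noncomputable def component (i : ℕ) : VermaSpace ⊗[ℂ] W →ₗ[ℂ] W :=
  (TensorProduct.lid ℂ W).toLinearMap ∘ₗ (Finsupp.lapply i : VermaSpace →ₗ[ℂ] ℂ).rTensor W

theorem component_tmul (i : ℕ) (x : VermaSpace) (w : W) : component i (x ⊗ₜ[ℂ] w) = x i • w := by
  simp [component]

theorem component_map {X : Type*} [AddCommGroup X] [Module ℂ X] (i : ℕ) (g : W →ₗ[ℂ] X)
    (x : VermaSpace ⊗[ℂ] W) :
    component i (TensorProduct.map LinearMap.id g x) = g (component i x) := by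
  induction x with
  | zero => simp
  | add x y hx hy => simp only [map_add, hx, hy]
  | tmul x y => simp [component_tmul]

theorem eq_zero_of_component {v : VermaSpace ⊗[ℂ] W} (H : ∀ i, component i v = 0) : v = 0 := by
  refine (TensorProduct.finsuppScalarLeft ℂ W ℕ).injective (Finsupp.ext fun i => ?_)
  rw [TensorProduct.finsuppScalarLeft_apply, map_zero]
  exact H i

theorem tensor_ext {f g : VermaSpace ⊗[ℂ] W →ₗ[ℂ] W}
    (H : ∀ k w, f (vec k ⊗ₜ w) = g (vec k ⊗ₜ w)) : f = g :=
  TensorProduct.ext (end_ext' fun k => LinearMap.ext fun w => H k w)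

/-- For a vector killed by E this becomes a recursion: since `[i+1] ≠ 0` and K is invertible,
component i determines component i + 1. -/
theorem component_E (B : UqModule h W) (l : ℂ) (i : ℕ) (x : VermaSpace ⊗[ℂ] W) :
    component i (((verma h hq l).tensor B).E x) =
      qnum h (i + 1) • B.K (component (i + 1) x) + qpow h (-(l - i)) • B.E (component i x) := by
  refine LinearMap.congr_fun (f := component i ∘ₗ _) (g := qnum h (i + 1) • (B.K ∘ₗ component (i + 1))
    + qpow h (-(l - i)) • (B.E ∘ₗ component i)) (tensor_ext fun k w => ?_) x
  have eE : (verma h hq l).E = vermaE h := rfl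
  have eK' : (verma h hq l).K' = vermaK' h l := rfl
  simp only [LinearMap.comp_apply, LinearMap.add_apply, LinearMap.smul_apply, tensor_E_tmul,
    map_add, component_tmul, eE, eK', vermaE_vec, vermaK'_vec, map_smul, Finsupp.smul_apply, vec_apply,
    smul_eq_mul, smul_smul]
  congr 1
  · rcases k with _ | k
    · simp [qnum_zero]
    · by_cases hk : k = i
      · subst hk; simp
      · simp [hk]
  · by_cases hk : k = i
    · subst hk; simp
    · simp [hk]

theorem component_K (B : UqModule h W) (l : ℂ) (i : ℕ) (x : VermaSpace ⊗[ℂ] W) :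
    component i (((verma h hq l).tensor B).K x) = qpow h (l - i) • B.K (component i x) := by
  refine LinearMap.congr_fun (f := component i ∘ₗ _) (g := qpow h (l - i) • (B.K ∘ₗ component i))
    (tensor_ext fun k w => ?_) x
  have eK : (verma h hq l).K = vermaK h l := rfl
  simp only [LinearMap.comp_apply, LinearMap.smul_apply, tensor_K_tmul,
    component_tmul, eK, vermaK_vec, map_smul, Finsupp.smul_apply, vec_apply,
    smul_eq_mul, smul_smul]
  by_cases hk : k = i
  · subst hk; simp
  · simp [hk]

/-- A singular vector of `M_l ⊗ W` is determined by its component along the highest weight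
vector of `M_l`. -/
theorem eq_zero_of_singular {B : UqModule h W} {l : ℂ} {v : VermaSpace ⊗[ℂ] W}
    (hE : ((verma h hq l).tensor B).E v = 0) (h0 : component 0 v = 0) : v = 0 := by
  refine eq_zero_of_component fun i => ?_
  induction i with
  | zero => exact h0
  | succ i ih =>
    have := component_E (hq := hq) B l i v
    rw [hE, map_zero, ih, map_zero, smul_zero, add_zero] at this
    have := (smul_eq_zero.mp this.symm).resolve_left (hq.qnum_ne_zero i)
    rw [← B.K'_K (component (i + 1) v), this, map_zero]

end Verma
noncomputable instance : AddCommGroup (VermaSpace ⊗[ℂ] VermaSpace) := TensorProduct.addCommGroup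

noncomputable instance : AddCommGroup (VermaSpace ⊗[ℂ] (VermaSpace ⊗[ℂ] VermaSpace)) :=
  TensorProduct.addCommGroup

noncomputable instance : AddCommGroup ((VermaSpace ⊗[ℂ] VermaSpace) ⊗[ℂ] VermaSpace) :=
  TensorProduct.addCommGroup (M := VermaSpace ⊗[ℂ] VermaSpace)

/-! ### The embeddings `psi` and their leading components -/

section Psi

open UqModule

variable {h : ℂ} (hq : NotRootOfUnity h) (D : ℂ → ℂ → ℂ → ℂ)

theorem psi_vec_zero (l1 l2 l : ℂ) : psi h hq D l1 l2 l (vec 0) = hwVec h D l1 l2 l := by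
  simp [psi, vec]

theorem tensor_K_hwVec {l1 l2 l : ℂ} {n : ℕ} (hn : l1 + l2 - l = n) :
    ((verma h hq l1).tensor (verma h hq l2)).K (hwVec h D l1 l2 l) =
      qpow h l • hwVec h D l1 l2 l := by
  have eK : ∀ l, (verma h hq l).K = vermaK h l := fun _ => rfl
  rw [hwVec, map_sum, Finset.smul_sum, hn, toN_natCast]
  refine Finset.sum_congr rfl fun i hi => ?_
  have hi : i ≤ n := Nat.lt_succ_iff.mp (Finset.mem_range.mp hi)
  rw [map_smul, tensor_K_tmul, eK, eK, vermaK_vec, vermaK_vec, TensorProduct.smul_tmul_smul,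
    ← qpow_add, smul_comm]
  congr 2
  rw [Nat.cast_sub hi, ← hn]
  ring

/-- Cancellation in neighbouring pairs: E ⊗ K on term i + 1 and K⁻¹ ⊗ E on term i land on the same
basis vector, with opposite signs. -/
theorem tensor_E_hwVec {l1 l2 l : ℂ} {n : ℕ} (hn : l1 + l2 - l = n) :
    ((verma h hq l1).tensor (verma h hq l2)).E (hwVec h D l1 l2 l) = 0 := by
  have eK : (verma h hq l2).K = vermaK h l2 := rfl
  have eK' : (verma h hq l1).K' = vermaK' h l1 := rfl
  have eE : ∀ l, (verma h hq l).E = vermaE h := fun _ => rfl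
  have hl : l = l1 + l2 - n := by rw [← hn]; ring
  rw [hwVec, map_sum, hn, toN_natCast]
  simp only [map_smul, tensor_E_tmul, eE, eK, eK', vermaE_vec, vermaK_vec, vermaK'_vec,
    TensorProduct.smul_tmul_smul, smul_add, smul_smul]
  -- The term i = 0 is split off the first sum and i = n off the second; both carry the factor [0] =
  -- 0.
  rw [Finset.sum_add_distrib, Finset.sum_range_succ', Finset.sum_range_succ]
  simp only [Nat.cast_zero, qnum_zero, Nat.sub_self, zero_mul, mul_zero, zero_smul, add_zero]
  rw [← Finset.sum_add_distrib]
  refine Finset.sum_eq_zero fun i hi => ?_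
  obtain ⟨k, rfl⟩ := Nat.exists_eq_add_of_lt (Finset.mem_range.mp hi)
  rw [show i + k + 1 - (i + 1) = k by omega, show i + k + 1 - i = k + 1 by omega,
    Nat.add_sub_cancel, Nat.add_sub_cancel, ← add_smul]
  convert zero_smul ℂ _ using 2
  have f1 : qfact h (i + 1) = qfact h i * qnum h (i + 1) := Finset.prod_range_succ _ _
  have f2 : qfact h (k + 1) = qfact h k * qnum h (k + 1) := Finset.prod_range_succ _ _
  have n1 := hq.qnum_ne_zero i
  have n2 := hq.qnum_ne_zero k
  have n3 := hq.qfact_ne_zero i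
  have n4 := hq.qfact_ne_zero k
  -- The exponent (l1 - i)(l + 1) in `hwVec` is chosen for this: lowering l1 - i by one costs l + 1
  -- = l1 + l2 - i - k, which the weights of K and K⁻¹ make up.
  have e : ∀ c, qpow h (c + (l1 - (i + 1 : ℕ)) * (l + 1)) * qpow h (l2 - k) =
      qpow h (c + (l1 - i) * (l + 1)) * qpow h (-(l1 - i)) := by
    intro c
    rw [← qpow_add, ← qpow_add, hl]
    congr 1
    push_cast
    ring
  have e' := e ((l2 * (l2 + 1) - l1 * (l1 + 1) - l * (l + 1)) / 2)
  rw [f1, f2]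
  push_cast at e' ⊢
  generalize qpow h (_ + (l1 - (i + 1)) * (l + 1)) = x at e' ⊢
  generalize qpow h (_ + (l1 - i) * (l + 1)) = y at e' ⊢
  field_simp
  rw [pow_succ]
  linear_combination (-D l1 l2 l * (-1) ^ i) * e'

theorem psi_isHom {l1 l2 l : ℂ} (hl : Generic h l) {n : ℕ} (hn : l1 + l2 - l = n) :
    (verma h hq l).IsHom ((verma h hq l1).tensor (verma h hq l2)) (psi h hq D l1 l2 l) :=
  isHom_linearCombination_of_highestWeight hl (tensor_E_hwVec hq D hn) (tensor_K_hwVec hq D hn)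

variable {D} (hD : IsDelta h D)
include hD

/-- Only the term i = 0 of `hwVec` has the highest weight vector in the first factor. Its nonzero
coefficient is what allows that factor to be stripped off. -/
theorem component_zero_psi {l1 l2 l : ℂ} (g1 : Generic h l1) (g2 : Generic h l2)
    (g : Generic h l) {n : ℕ} (hn : l1 + l2 - l = n) :
    ∃ d : ℂ, d ≠ 0 ∧ component 0 (psi h hq D l1 l2 l (vec 0)) = d • vec n := by
  rw [psi_vec_zero, hwVec, hn, toN_natCast, map_sum, Finset.sum_eq_single 0]
  · rw [map_smul, component_tmul, vec_apply, if_pos rfl, one_smul]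
    refine ⟨_, ?_, rfl⟩
    refine div_ne_zero (mul_ne_zero (mul_ne_zero ?_ (by simp)) (qpow_ne_zero _ _))
      (mul_ne_zero (hq.qfact_ne_zero _) (hq.qfact_ne_zero _))
    exact hD.ne_zero hq g1 g2 g ⟨n, hn⟩
  · intro i _ hi
    rw [map_smul, component_tmul, vec_apply, if_neg hi, zero_smul, smul_zero]
  · simp

theorem psi_ne_zero {l1 l2 l : ℂ} (g1 : Generic h l1) (g2 : Generic h l2)
    (g : Generic h l) {n : ℕ} (hn : l1 + l2 - l = n) : psi h hq D l1 l2 l ≠ 0 := by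
  obtain ⟨d, hd, e⟩ := component_zero_psi hq hD g1 g2 g hn
  intro H
  rw [H, LinearMap.zero_apply, map_zero] at e
  have := congrArg (fun x : VermaSpace => x n) e
  simp [vec_apply, hd.symm] at this

/-- Homomorphisms `f m : M_{ν-m} → W` can be recovered from the sum of the compositions
`M_l → M_{l1} ⊗ M_{ν-m} → M_{l1} ⊗ W`. -/
theorem hom_eq_zero_of_sum_map_psi {W : Type*} [AddCommGroup W] [Module ℂ W] {B : UqModule h W}
    {l1 ν l : ℂ} (g1 : Generic h l1) (hν : Generic h ν) (g : Generic h l) {n : ℕ}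
    (hn : l1 + ν - l = n) {f : ℕ → VermaSpace →ₗ[ℂ] W}
    (hf : ∀ m ≤ n, (verma h hq (ν - m)).IsHom B (f m))
    (H : ∑ m ∈ Finset.range (n + 1),
      TensorProduct.map LinearMap.id (f m) (psi h hq D l1 (ν - m) l (vec 0)) = 0) :
    ∀ m ≤ n, f m = 0 := by
  have hd : ∀ m ≤ n, ∃ d : ℂ, d ≠ 0 ∧
      component 0 (psi h hq D l1 (ν - m) l (vec 0)) = d • vec (n - m) := by
    intro m hm
    refine component_zero_psi hq hD g1 (hν.sub_natCast m) g ?_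
    rw [Nat.cast_sub hm, ← hn]
    ring
  choose! d hd0 hd using hd
  have H' := congrArg (component 0) H
  rw [map_sum, map_zero] at H'
  -- The component 0 of the hypothesis reads `∑ d m • f m (vec (n - m)) = 0`.
  have := hom_eq_zero_of_sum_eq_zero (n := n) (f := fun m => d m • f m) hν
    (fun m hm => (hf m hm).smul _) (by
      rw [← H']
      refine Finset.sum_congr rfl fun m hm => ?_
      rw [component_map, hd m (Nat.lt_succ_iff.mp (Finset.mem_range.mp hm)), map_smul,
        LinearMap.smul_apply])
  exact fun m hm => (smul_eq_zero.mp (this m hm)).resolve_left (hd0 m hm)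

theorem hom_eq_of_sum_map_psi_eq {W : Type*} [AddCommGroup W] [Module ℂ W] {B : UqModule h W}
    {l1 ν l : ℂ} (g1 : Generic h l1) (hν : Generic h ν) (g : Generic h l) {n : ℕ}
    (hn : l1 + ν - l = n) {f f' : ℕ → VermaSpace →ₗ[ℂ] W}
    (hf : ∀ m ≤ n, (verma h hq (ν - m)).IsHom B (f m))
    (hf' : ∀ m ≤ n, (verma h hq (ν - m)).IsHom B (f' m))
    (H : ∑ m ∈ Finset.range (n + 1),
        TensorProduct.map LinearMap.id (f m) (psi h hq D l1 (ν - m) l (vec 0)) =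
      ∑ m ∈ Finset.range (n + 1),
        TensorProduct.map LinearMap.id (f' m) (psi h hq D l1 (ν - m) l (vec 0))) :
    ∀ m ≤ n, f m = f' m := by
  intro m hm
  have := hom_eq_zero_of_sum_map_psi hq hD g1 hν g hn (f := fun m => f m + (-1 : ℂ) • f' m)
    (fun m hm => (hf m hm).add ((hf' m hm).smul _)) (by
      simp only [TensorProduct.map_add_right, TensorProduct.map_smul_right, LinearMap.add_apply,
        LinearMap.smul_apply]
      rw [Finset.sum_add_distrib, ← Finset.smul_sum, H]
      nth_rw 1 [← one_smul ℂ (Finset.sum _ _)]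
      rw [← add_smul, add_neg_cancel, zero_smul]) m hm
  rwa [neg_one_smul, add_neg_eq_zero] at this

end Psi

/-! ### Weight spaces of a product of two Verma modules -/

section WeightSpace

open UqModule

variable {h : ℂ} (hq : NotRootOfUnity h)

/-- The space of vectors of weight `l1 + l2 - n` in `M_{l1} ⊗ M_{l2}`. -/
noncomputable def weightSpace (l1 l2 : ℂ) (n : ℕ) : Submodule ℂ (VermaSpace ⊗[ℂ] VermaSpace) :=
  LinearMap.ker (((verma h hq l1).tensor (verma h hq l2)).K - qpow h (l1 + l2 - n) • LinearMap.id)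

variable {hq} in
theorem mem_weightSpace {l1 l2 : ℂ} {n : ℕ} {x : VermaSpace ⊗[ℂ] VermaSpace} :
    x ∈ weightSpace hq l1 l2 n ↔
      ((verma h hq l1).tensor (verma h hq l2)).K x = qpow h (l1 + l2 - n) • x := by
  simp [weightSpace, sub_eq_zero]

theorem vermaK_apply (l : ℂ) (x : VermaSpace) (k : ℕ) :
    vermaK h l x k = qpow h (l - k) * x k := by
  refine LinearMap.congr_fun (f := Finsupp.lapply k ∘ₗ vermaK h l)
    (g := qpow h (l - k) • Finsupp.lapply k) (end_ext' fun j => ?_) x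
  by_cases hj : j = k
  · subst hj; simp [vermaK_vec]
  · simp [vermaK_vec, vec_apply, hj]

/-- The coordinates, with respect to the vectors `e_{l1-i} ⊗ e_{l2-(n-i)}`. -/
noncomputable def coordinates (n : ℕ) :
    VermaSpace ⊗[ℂ] VermaSpace →ₗ[ℂ] (Fin (n + 1) → ℂ) :=
  LinearMap.pi fun i => (Finsupp.lapply (n - i.val : ℕ) : VermaSpace →ₗ[ℂ] ℂ) ∘ₗ component i.val

/-- The basis vector at position (i, k) has K-eigenvalue q^(l1+l2-i-k), so a vector in this weight
space is supported on i + k = n, that is, on n + 1 positions. -/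
theorem coordinates_injOn (l1 l2 : ℂ) (n : ℕ) :
    Function.Injective ((coordinates n).domRestrict (weightSpace hq l1 l2 n)) := by
  rw [← LinearMap.ker_eq_bot, LinearMap.ker_eq_bot']
  rintro ⟨x, hx⟩ H
  rw [mem_weightSpace] at hx
  refine Subtype.ext (eq_zero_of_component fun i => Finsupp.ext fun k => ?_)
  change component i x k = 0
  by_cases hik : i + k = n
  · have := congrFun H ⟨i, by omega⟩
    subst hik
    simpa [coordinates] using this
  · have e := congrArg (fun y : VermaSpace => y k) (congrArg (component i) hx)
    rw [component_K, show (verma h hq l2).K = vermaK h l2 from rfl, map_smul, Finsupp.smul_apply,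
      Finsupp.smul_apply, vermaK_apply, smul_eq_mul, smul_eq_mul, ← mul_assoc, ← qpow_add] at e
    by_contra h0
    refine hik (hq.qpow_sub_natCast_inj (c := l1 + l2) ?_)
    rw [← mul_right_cancel₀ h0 e]
    push_cast
    ring_nf

theorem finrank_weightSpace_le (l1 l2 : ℂ) (n : ℕ) :
    FiniteDimensional ℂ (weightSpace hq l1 l2 n) ∧
      Module.finrank ℂ (weightSpace hq l1 l2 n) ≤ n + 1 := by
  refine ⟨FiniteDimensional.of_injective _ (coordinates_injOn hq l1 l2 n), ?_⟩
  simpa using LinearMap.finrank_le_finrank_of_injective (coordinates_injOn hq l1 l2 n)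

/-- A dimension count: the n + 1 vectors on the right have the required weight and are independent
by `hom_eq_zero_of_sum_eq_zero`, while the weight space has dimension at most n + 1. This is the
decomposition of the tensor product into Verma modules, one weight at a time. -/
theorem exists_eq_sum_psi {D : ℂ → ℂ → ℂ → ℂ} (hD : IsDelta h D) {l1 l2 : ℂ}
    (g1 : Generic h l1) (g2 : Generic h l2) (g : Generic h (l1 + l2)) {n : ℕ}
    {w : VermaSpace ⊗[ℂ] VermaSpace} (hw : w ∈ weightSpace hq l1 l2 n) :
    ∃ a : ℕ → ℂ, w = ∑ m ∈ Finset.range (n + 1),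
      a m • psi h hq D l1 l2 (l1 + l2 - m) (vec (n - m)) := by
  have hm : ∀ m : ℕ, l1 + l2 - (l1 + l2 - m) = (m : ℂ) := fun m => by ring
  let u : Fin (n + 1) → weightSpace hq l1 l2 n := fun m =>
    ⟨psi h hq D l1 l2 (l1 + l2 - (m.val : ℕ)) (vec (n - m.val)), by
      rw [mem_weightSpace, ← (psi_isHom hq D (g.sub_natCast m.val) (hm m.val)).K,
        show (verma h hq (l1 + l2 - (m.val : ℕ))).K = vermaK h _ from rfl, vermaK_vec, map_smul,
        Nat.cast_sub (Nat.lt_succ_iff.mp m.isLt)]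
      congr 2
      ring⟩
  have hu : LinearIndependent ℂ u := by
    rw [Fintype.linearIndependent_iff]
    intro c hc i
    let c' : ℕ → ℂ := fun m => if hm : m < n + 1 then c ⟨m, hm⟩ else 0
    have hc' : ∀ i : Fin (n + 1), c' i = c i := fun i => dif_pos i.isLt
    have := hom_eq_zero_of_sum_eq_zero (n := n) g
      (f := fun m => c' m • psi h hq D l1 l2 (l1 + l2 - m))
      (fun m _ => (psi_isHom hq D (g.sub_natCast m) (hm m)).smul _) (by
        rw [Finset.sum_range]
        have := congrArg (weightSpace hq l1 l2 n).subtype hc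
        simpa [u, hc'] using this) i (Nat.lt_succ_iff.mp i.isLt)
    rw [← hc']
    exact (smul_eq_zero.mp this).resolve_right
      (psi_ne_zero hq hD g1 g2 (g.sub_natCast _) (hm _))
  obtain ⟨_, hle⟩ := finrank_weightSpace_le hq l1 l2 n
  have hge := hu.fintype_card_le_finrank
  rw [Fintype.card_fin] at hge
  have hspan := hu.span_eq_top_of_card_eq_finrank' (by rw [Fintype.card_fin]; omega)
  have hmem : (⟨w, hw⟩ : weightSpace hq l1 l2 n) ∈ Submodule.span ℂ (Set.range u) :=
    hspan ▸ Submodule.mem_top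
  obtain ⟨c, hc⟩ := (Submodule.mem_span_range_iff_exists_fun ℂ).mp hmem
  refine ⟨fun m => if hm : m < n + 1 then c ⟨m, hm⟩ else 0, ?_⟩
  rw [Finset.sum_range]
  have := congrArg (weightSpace hq l1 l2 n).subtype hc
  simp only [Fin.is_lt, dif_pos]
  simpa [u] using this.symm

end WeightSpace

/-! ### Existence and uniqueness of recoupling coefficients -/

section Recoupling

open UqModule

variable {h : ℂ} (hq : NotRootOfUnity h) (D : ℂ → ℂ → ℂ → ℂ)

/-- The composition `M_l → M_{l12} ⊗ M_{l3} → (M_{l1} ⊗ M_{l2}) ⊗ M_{l3}`, rebracketed. -/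
noncomputable def leftMap (l1 l2 l12 l3 l : ℂ) :
    VermaSpace →ₗ[ℂ] VermaSpace ⊗[ℂ] (VermaSpace ⊗[ℂ] VermaSpace) :=
  (TensorProduct.assoc ℂ VermaSpace VermaSpace VermaSpace).toLinearMap ∘ₗ
    TensorProduct.map (psi h hq D l1 l2 l12) LinearMap.id ∘ₗ psi h hq D l12 l3 l

/-- The composition `M_l → M_{l1} ⊗ M_{l23} → M_{l1} ⊗ (M_{l2} ⊗ M_{l3})`. -/
noncomputable def rightMap (l1 l2 l3 l23 l : ℂ) :
    VermaSpace →ₗ[ℂ] VermaSpace ⊗[ℂ] (VermaSpace ⊗[ℂ] VermaSpace) :=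
  TensorProduct.map LinearMap.id (psi h hq D l2 l3 l23) ∘ₗ psi h hq D l1 l23 l

theorem leftMap_isHom {l1 l2 l12 l3 l : ℂ} (g12 : Generic h l12) (g : Generic h l)
    {n m : ℕ} (hn : l1 + l2 - l12 = n) (hm : l12 + l3 - l = m) :
    (verma h hq l).IsHom
      ((verma h hq l1).tensor ((verma h hq l2).tensor (verma h hq l3)))
      (leftMap hq D l1 l2 l12 l3 l) :=
  (isHom_assoc _ _ _).comp
    (((psi_isHom hq D g12 hn).map (IsHom.id _)).comp (psi_isHom hq D g hm))

theorem rightMap_isHom {l1 l2 l23 l3 l : ℂ} (g23 : Generic h l23) (g : Generic h l)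
    {n m : ℕ} (hn : l2 + l3 - l23 = n) (hm : l1 + l23 - l = m) :
    (verma h hq l).IsHom
      ((verma h hq l1).tensor ((verma h hq l2).tensor (verma h hq l3)))
      (rightMap hq D l1 l2 l3 l23 l) :=
  ((IsHom.id _).map (psi_isHom hq D g23 hn)).comp (psi_isHom hq D g hm)

/-- Passes from vectors in the bracketing (12)3 to homomorphisms in the bracketing 1(23), where the
first factor can be split off. -/
theorem expansion_iff {l1 l2 l12 l3 l : ℂ} {n : ℕ} {c : ℕ → ℂ} :
    (∀ k : ℕ, leftVec h hq D l1 l2 l12 l3 l k =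
      ∑ m ∈ Finset.range (n + 1), c m • rightVec h hq D l1 l2 l3 (l2 + l3 - m) l k) ↔
    leftMap hq D l1 l2 l12 l3 l =
      ∑ m ∈ Finset.range (n + 1), c m • rightMap hq D l1 l2 l3 (l2 + l3 - m) l := by
  have key : ∀ k, (leftVec h hq D l1 l2 l12 l3 l k =
      ∑ m ∈ Finset.range (n + 1), c m • rightVec h hq D l1 l2 l3 (l2 + l3 - m) l k) ↔
      leftMap hq D l1 l2 l12 l3 l (vec k) =
      (∑ m ∈ Finset.range (n + 1), c m • rightMap hq D l1 l2 l3 (l2 + l3 - m) l) (vec k) := by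
    intro k
    rw [← (TensorProduct.assoc ℂ VermaSpace VermaSpace VermaSpace).injective.eq_iff]
    simp [leftMap, rightMap, leftVec, rightVec]
  simp only [key]
  exact ⟨end_ext', fun H k => H ▸ rfl⟩

variable {D} (hD : IsDelta h D)
include hD

/-- Both sides are homomorphisms from `M_l`, so it suffices to match their singular vectors, hence
only the components along the highest weight vector of `M_l1`. Those lie in a weight space spanned
by images of the `psi`. -/
theorem exists_expansion {l1 l2 l12 l3 l : ℂ} (g1 : Generic h l1) (g2 : Generic h l2)
    (g3 : Generic h l3) (g12 : Generic h l12) (g23 : Generic h (l2 + l3)) (g : Generic h l)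
    {N p r : ℕ} (hN : l1 + l2 + l3 - l = N) (hp : l1 + l2 - l12 = p) (hr : l12 + l3 - l = r) :
    ∃ c : ℕ → ℂ, leftMap hq D l1 l2 l12 l3 l =
      ∑ m ∈ Finset.range (N + 1), c m • rightMap hq D l1 l2 l3 (l2 + l3 - m) l := by
  have hL := leftMap_isHom hq D g12 g hp hr
  have hm : ∀ m : ℕ, l2 + l3 - (l2 + l3 - m) = (m : ℂ) := fun m => by ring
  have hm' : ∀ m ≤ N, l1 + (l2 + l3 - m) - l = ((N - m : ℕ) : ℂ) := fun m hmN => by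
    rw [Nat.cast_sub hmN, ← hN]; ring
  have hR : ∀ m ≤ N, _ := fun m hmN =>
    rightMap_isHom hq D (g23.sub_natCast m) g (hm m) (hm' m hmN)
  -- Removing the factor q^l1 of the first tensor slot leaves weight l - l1 = l2 + l3 - N.
  have hw : component 0 (leftMap hq D l1 l2 l12 l3 l (vec 0)) ∈ weightSpace hq l2 l3 N := by
    have e := congrArg (component 0) (hL.K (vec 0))
    rw [component_K, show (verma h hq l).K = vermaK h l from rfl, vermaK_vec, map_smul, map_smul]
      at e
    rw [mem_weightSpace]
    refine smul_right_injective _ (qpow_ne_zero h (l1 - (0 : ℕ))) ?_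
    simp only
    rw [← e, smul_smul, ← qpow_add, ← hN]
    congr 2
    ring
  obtain ⟨a, ha⟩ := exists_eq_sum_psi hq hD g2 g3 g23 hw
  have hd : ∀ m ≤ N, ∃ d : ℂ, d ≠ 0 ∧
      component 0 (psi h hq D l1 (l2 + l3 - m) l (vec 0)) = d • vec (N - m) := fun m hmN =>
    component_zero_psi hq hD g1 (g23.sub_natCast m) g (hm' m hmN)
  choose! d hd0 hd using hd
  -- The m-th right map contributes `d m` times the m-th spanning vector, hence the division.
  refine ⟨fun m => a m / d m, ?_⟩
  have hS : (verma h hq l).IsHom _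
      (∑ m ∈ Finset.range (N + 1), (a m / d m) • rightMap hq D l1 l2 l3 (l2 + l3 - m) l) :=
    IsHom.sum fun m hmN => (hR m (Nat.lt_succ_iff.mp (Finset.mem_range.mp hmN))).smul _
  refine sub_eq_zero.mp (hom_verma_eq_zero g (hL.sub hS) (eq_zero_of_singular
    (hq := hq) (l := l1) (B := (verma h hq l2).tensor (verma h hq l3)) ?_ ?_))
  · rw [← (hL.sub hS).E, show (verma h hq l).E = vermaE h from rfl, vermaE_vec, Nat.cast_zero,
      qnum_zero, zero_smul, map_zero]
  · rw [LinearMap.sub_apply, map_sub, ha, LinearMap.sum_apply, map_sum, sub_eq_zero]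
    refine Finset.sum_congr rfl fun m hmN => ?_
    have hmN := Nat.lt_succ_iff.mp (Finset.mem_range.mp hmN)
    rw [LinearMap.smul_apply, map_smul, rightMap, LinearMap.comp_apply, component_map, hd m hmN,
      map_smul, smul_smul, div_mul_cancel₀ _ (hd0 m hmN)]

/-- The coefficients are absorbed into the inner maps, `c m • psi`, which the sum determines; then
`psi ≠ 0` gives back `c m`. -/
theorem expansion_unique {l1 l2 l3 l : ℂ} (g1 : Generic h l1) (g2 : Generic h l2)
    (g3 : Generic h l3) (g23 : Generic h (l2 + l3)) (g : Generic h l)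
    {N : ℕ} (hN : l1 + l2 + l3 - l = N) {c c' : ℕ → ℂ}
    (H : ∑ m ∈ Finset.range (N + 1), c m • rightMap hq D l1 l2 l3 (l2 + l3 - m) l =
      ∑ m ∈ Finset.range (N + 1), c' m • rightMap hq D l1 l2 l3 (l2 + l3 - m) l) :
    ∀ m ≤ N, c m = c' m := by
  have hm : ∀ m : ℕ, l2 + l3 - (l2 + l3 - m) = (m : ℂ) := fun m => by ring
  intro m hmN
  have e : ∀ c : ℕ → ℂ, (∑ m ∈ Finset.range (N + 1),
      c m • rightMap hq D l1 l2 l3 (l2 + l3 - m) l) (vec 0) =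
      ∑ m ∈ Finset.range (N + 1), TensorProduct.map LinearMap.id
        (c m • psi h hq D l2 l3 (l2 + l3 - m)) (psi h hq D l1 (l2 + l3 - m) l (vec 0)) := by
    intro c
    rw [LinearMap.sum_apply]
    refine Finset.sum_congr rfl fun m _ => ?_
    rw [TensorProduct.map_smul_right]
    rfl
  have hψ : ∀ c : ℕ → ℂ, ∀ m ≤ N, (verma h hq (l2 + l3 - m)).IsHom
      ((verma h hq l2).tensor (verma h hq l3)) (c m • psi h hq D l2 l3 (l2 + l3 - m)) :=
    fun c m _ => (psi_isHom hq D (g23.sub_natCast m) (hm m)).smul _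
  exact smul_left_injective ℂ (psi_ne_zero hq hD g2 g3 (g23.sub_natCast m) (hm m))
    (hom_eq_of_sum_map_psi_eq hq hD g1 g23 g (n := N) (by rw [← hN]; ring) (hψ c) (hψ c')
      (by rw [← e, ← e, H]) m hmN)

theorem hasRecoupling {l1 l2 l12 l3 l : ℂ} (g1 : Generic h l1) (g2 : Generic h l2)
    (g3 : Generic h l3) (g12 : Generic h l12) (g23 : Generic h (l2 + l3)) (g : Generic h l)
    (hp : IsNat (l1 + l2 - l12)) (hr : IsNat (l12 + l3 - l)) :
    HasRecoupling h hq D l1 l2 l12 l3 l := by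
  obtain ⟨p, hp⟩ := hp
  obtain ⟨r, hr⟩ := hr
  have hN : l1 + l2 + l3 - l = (p + r : ℕ) := by push_cast; rw [← hp, ← hr]; ring
  obtain ⟨c, hc⟩ := exists_expansion hq hD g1 g2 g3 g12 g23 g hN hp hr
  unfold HasRecoupling IsRecoupling
  simp only [hN, toN_natCast, expansion_iff]
  -- Truncation to the range of the expansion; without the convention of zeros beyond it, uniqueness
  -- as a function on ℕ would fail.
  refine ⟨fun m => if m ≤ p + r then c m else 0, ⟨fun m hm => if_neg (by omega), ?_⟩, ?_⟩
  · rw [hc]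
    refine Finset.sum_congr rfl fun m hm => ?_
    simp only
    rw [if_pos (Nat.lt_succ_iff.mp (Finset.mem_range.mp hm))]
  · rintro c' ⟨h0, hc'⟩
    funext m
    split_ifs with hm
    · exact expansion_unique hq hD g1 g2 g3 g23 g hN (hc'.symm.trans hc) m hm
    · exact h0 m (by omega)

omit hD in
theorem leftMap_eq_sum_q6j {l1 l2 l12 l3 l : ℂ} (H : HasRecoupling h hq D l1 l2 l12 l3 l)
    {N : ℕ} (hN : l1 + l2 + l3 - l = N) :
    leftMap hq D l1 l2 l12 l3 l = ∑ m ∈ Finset.range (N + 1),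
      q6j h hq D l1 l2 l12 l3 l (l2 + l3 - m) • rightMap hq D l1 l2 l3 (l2 + l3 - m) l := by
  have hc := H.exists.choose_spec.2
  rw [hN, toN_natCast, expansion_iff] at hc
  rw [hc]
  refine Finset.sum_congr rfl fun m _ => ?_
  rw [q6j, dif_pos H.exists, show l2 + l3 - (l2 + l3 - m) = (m : ℂ) by ring, toN_natCast]

end Recoupling

/-! ### Naturality and Mac Lane pentagon for the associator -/

section Assoc

variable {V₁ V₂ V₃ V₄ W : Type*} [AddCommMonoid V₁] [Module ℂ V₁] [AddCommMonoid V₂] [Module ℂ V₂]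
  [AddCommMonoid V₃] [Module ℂ V₃] [AddCommMonoid V₄] [Module ℂ V₄] [AddCommMonoid W] [Module ℂ W]

theorem assoc_map_left (g : V₁ →ₗ[ℂ] W) (x : (V₁ ⊗[ℂ] V₂) ⊗[ℂ] V₃) :
    TensorProduct.assoc ℂ W V₂ V₃
        (TensorProduct.map (TensorProduct.map g LinearMap.id) LinearMap.id x) =
      TensorProduct.map g LinearMap.id (TensorProduct.assoc ℂ V₁ V₂ V₃ x) := by
  induction x with
  | zero => simp
  | add x y hx hy => simp only [map_add, hx, hy]
  | tmul x z =>
    induction x with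
    | zero => simp
    | add x y hx hy => simp only [TensorProduct.add_tmul, map_add, hx, hy]
    | tmul x y => simp [← TensorProduct.map_id]

theorem assoc_map_middle (g : V₂ →ₗ[ℂ] W) (x : (V₁ ⊗[ℂ] V₂) ⊗[ℂ] V₃) :
    TensorProduct.assoc ℂ V₁ W V₃
        (TensorProduct.map (TensorProduct.map LinearMap.id g) LinearMap.id x) =
      TensorProduct.map LinearMap.id (TensorProduct.map g LinearMap.id)
        (TensorProduct.assoc ℂ V₁ V₂ V₃ x) := by
  induction x with
  | zero => simp
  | add x y hx hy => simp only [map_add, hx, hy]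
  | tmul x z =>
    induction x with
    | zero => simp
    | add x y hx hy => simp only [TensorProduct.add_tmul, map_add, hx, hy]
    | tmul x y => simp

theorem assoc_map_right (g : V₃ →ₗ[ℂ] W) (x : (V₁ ⊗[ℂ] V₂) ⊗[ℂ] V₃) :
    TensorProduct.assoc ℂ V₁ V₂ W (TensorProduct.map LinearMap.id g x) =
      TensorProduct.map LinearMap.id (TensorProduct.map LinearMap.id g)
        (TensorProduct.assoc ℂ V₁ V₂ V₃ x) := by
  induction x with
  | zero => simp
  | add x y hx hy => simp only [map_add, hx, hy]
  | tmul x z =>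
    induction x with
    | zero => simp
    | add x y hx hy => simp only [TensorProduct.add_tmul, map_add, hx, hy]
    | tmul x y => simp

theorem assoc_pentagon (x : ((V₁ ⊗[ℂ] V₂) ⊗[ℂ] V₃) ⊗[ℂ] V₄) :
    TensorProduct.map LinearMap.id (TensorProduct.assoc ℂ V₂ V₃ V₄).toLinearMap
        (TensorProduct.assoc ℂ V₁ (V₂ ⊗[ℂ] V₃) V₄
          (TensorProduct.map (TensorProduct.assoc ℂ V₁ V₂ V₃).toLinearMap LinearMap.id x)) =
      TensorProduct.assoc ℂ V₁ V₂ (V₃ ⊗[ℂ] V₄) (TensorProduct.assoc ℂ (V₁ ⊗[ℂ] V₂) V₃ V₄ x) := by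
  induction x with
  | zero => simp
  | add x y hx hy => simp only [map_add, hx, hy]
  | tmul x t =>
    induction x with
    | zero => simp
    | add x y hx hy => simp only [TensorProduct.add_tmul, map_add, hx, hy]
    | tmul x z =>
      induction x with
      | zero => simp
      | add x y hx hy => simp only [TensorProduct.add_tmul, map_add, hx, hy]
      | tmul x y => simp

end Assoc

/-- Collects a double recoupling by its final weight: lowering first by j and then by m lowers l2 +
l3 + l4 by k = j + m in total. -/
theorem sum_range_sum_range_add {M : Type*} [AddCommMonoid M] {A T : ℕ} (hAT : A ≤ T)
    (f : ℕ → ℕ → M) :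
    ∑ j ∈ Finset.range (A + 1), ∑ m ∈ Finset.range (T - j + 1), f j (j + m) =
      ∑ k ∈ Finset.range (T + 1), ∑ j ∈ Finset.range (min k A + 1), f j k := by
  rw [Finset.sum_sigma', Finset.sum_sigma']
  refine Finset.sum_bij' (fun x _ => ⟨x.1 + x.2, x.1⟩) (fun x _ => ⟨x.2, x.1 - x.2⟩) ?_ ?_ ?_ ?_ ?_
  · rintro ⟨j, m⟩ hx
    simp only [Finset.mem_sigma, Finset.mem_range] at hx ⊢
    omega
  · rintro ⟨k, j⟩ hx
    simp only [Finset.mem_sigma, Finset.mem_range] at hx ⊢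
    omega
  · rintro ⟨j, m⟩ hx
    simp
  · rintro ⟨k, j⟩ hx
    simp only [Finset.mem_sigma, Finset.mem_range] at hx
    simp only [Sigma.mk.injEq, heq_eq_eq, and_true]
    omega
  · rintro ⟨j, m⟩ hx
    rfl

/-! ### Two expansions of the fourfold embedding -/

section Pentagon

variable {h : ℂ} (hq : NotRootOfUnity h) (D : ℂ → ℂ → ℂ → ℂ)

/-- The embedding of `M_l` into `((M_{l1} ⊗ M_{l2}) ⊗ M_{l3}) ⊗ M_{l4}` by way of
`M_{l123} ⊗ M_{l4}` and `(M_{l12} ⊗ M_{l3}) ⊗ M_{l4}`, rebracketed. -/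
noncomputable def fourfoldMap (l1 l2 l12 l3 l123 l4 l : ℂ) :
    VermaSpace →ₗ[ℂ] VermaSpace ⊗[ℂ] (VermaSpace ⊗[ℂ] (VermaSpace ⊗[ℂ] VermaSpace)) :=
  TensorProduct.map LinearMap.id
      (TensorProduct.assoc ℂ VermaSpace VermaSpace VermaSpace).toLinearMap ∘ₗ
    (TensorProduct.assoc ℂ VermaSpace (VermaSpace ⊗[ℂ] VermaSpace) VermaSpace).toLinearMap ∘ₗ
    TensorProduct.map (leftMap hq D l1 l2 l12 l3 l123) LinearMap.id ∘ₗ psi h hq D l123 l4 l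

/-- Two moves: (12)3 to 1(23) inside the first three factors, then (1(23))4 to 1((23)4). The inner
maps that remain couple 2 with 3 first. -/
theorem fourfoldMap_eq_sum_left {l1 l2 l12 l3 l123 l4 l : ℂ} {A T : ℕ}
    (hA : l1 + l2 + l3 - l123 = A) (hT : l1 + l2 + l3 + l4 - l = T) (hAT : A ≤ T)
    (H : HasRecoupling h hq D l1 l2 l12 l3 l123)
    (H' : ∀ j ≤ A, HasRecoupling h hq D l1 (l2 + l3 - j) l123 l4 l) (x : VermaSpace) :
    fourfoldMap hq D l1 l2 l12 l3 l123 l4 l x =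
      ∑ k ∈ Finset.range (T + 1), TensorProduct.map LinearMap.id
        (∑ j ∈ Finset.range (min k A + 1),
          (q6j h hq D l1 l2 l12 l3 l123 (l2 + l3 - j) *
            q6j h hq D l1 (l2 + l3 - j) l123 l4 l (l2 + l3 + l4 - k)) •
          leftMap hq D l2 l3 (l2 + l3 - j) l4 (l2 + l3 + l4 - k))
        (psi h hq D l1 (l2 + l3 + l4 - k) l x) := by
  have step : ∀ j ≤ A, TensorProduct.map LinearMap.id
        (TensorProduct.assoc ℂ VermaSpace VermaSpace VermaSpace).toLinearMap
        (TensorProduct.assoc ℂ VermaSpace (VermaSpace ⊗[ℂ] VermaSpace) VermaSpace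
          (TensorProduct.map (rightMap hq D l1 l2 l3 (l2 + l3 - j) l123) LinearMap.id
            (psi h hq D l123 l4 l x))) =
      ∑ m ∈ Finset.range (T - j + 1),
        q6j h hq D l1 (l2 + l3 - j) l123 l4 l (l2 + l3 + l4 - (j + m : ℕ)) •
          TensorProduct.map LinearMap.id
            (leftMap hq D l2 l3 (l2 + l3 - j) l4 (l2 + l3 + l4 - (j + m : ℕ)))
            (psi h hq D l1 (l2 + l3 + l4 - (j + m : ℕ)) l x) := by
    intro j hj
    have e := LinearMap.congr_fun (leftMap_eq_sum_q6j hq (H' j hj) (N := T - j) (by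
      rw [Nat.cast_sub (hj.trans hAT), ← hT]; ring)) x
    have e1 : TensorProduct.map (rightMap hq D l1 l2 l3 (l2 + l3 - j) l123) LinearMap.id
        (psi h hq D l123 l4 l x) =
      TensorProduct.map (TensorProduct.map LinearMap.id (psi h hq D l2 l3 (l2 + l3 - j)))
        LinearMap.id (TensorProduct.map (psi h hq D l1 (l2 + l3 - j) l123) LinearMap.id
          (psi h hq D l123 l4 l x)) := by
      rw [TensorProduct.map_map]
      rfl
    -- Naturality moves the splitting of factor 23 outside, exposing a left map for the triple 1,
    -- 23, 4.
    rw [e1, assoc_map_middle]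
    change TensorProduct.map LinearMap.id _ (TensorProduct.map LinearMap.id _
      (leftMap hq D l1 (l2 + l3 - j) l123 l4 l x)) = _
    rw [e, LinearMap.sum_apply, map_sum, map_sum]
    refine Finset.sum_congr rfl fun m _ => ?_
    have em : l2 + l3 + l4 - (j + m : ℕ) = l2 + l3 - j + l4 - m := by push_cast; ring
    rw [em, LinearMap.smul_apply, map_smul, map_smul, rightMap, LinearMap.comp_apply,
      TensorProduct.map_map, TensorProduct.map_map]
    rfl
  have e0 : fourfoldMap hq D l1 l2 l12 l3 l123 l4 l x =
      ∑ j ∈ Finset.range (A + 1), q6j h hq D l1 l2 l12 l3 l123 (l2 + l3 - j) •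
      TensorProduct.map LinearMap.id
        (TensorProduct.assoc ℂ VermaSpace VermaSpace VermaSpace).toLinearMap
        (TensorProduct.assoc ℂ VermaSpace (VermaSpace ⊗[ℂ] VermaSpace) VermaSpace
          (TensorProduct.map (rightMap hq D l1 l2 l3 (l2 + l3 - j) l123) LinearMap.id
            (psi h hq D l123 l4 l x))) := by
    rw [fourfoldMap, leftMap_eq_sum_q6j hq H hA]
    simp only [LinearMap.comp_apply, ← TensorProduct.mapBilinear_apply, map_sum, map_smul,
      LinearMap.sum_apply, LinearMap.smul_apply, LinearEquiv.coe_coe]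
  rw [e0]
  have e2 := sum_range_sum_range_add hAT fun j k =>
    (q6j h hq D l1 l2 l12 l3 l123 (l2 + l3 - j) *
      q6j h hq D l1 (l2 + l3 - j) l123 l4 l (l2 + l3 + l4 - k)) •
        TensorProduct.map LinearMap.id (leftMap hq D l2 l3 (l2 + l3 - j) l4 (l2 + l3 + l4 - k))
          (psi h hq D l1 (l2 + l3 + l4 - k) l x)
  refine (Finset.sum_congr rfl fun j hj => ?_).trans (e2.trans (Finset.sum_congr rfl fun k _ => ?_))
  · rw [step j (Nat.lt_succ_iff.mp (Finset.mem_range.mp hj)), Finset.smul_sum]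
    simp only [smul_smul]
  · simp only [← TensorProduct.mapBilinear_apply, map_sum, map_smul, LinearMap.sum_apply,
      LinearMap.smul_apply]

/-- Two moves: ((12)3)4 to (12)(34), then (12)(34) to 1(2(34)). The inner maps that remain couple 3
with 4 first. -/
theorem fourfoldMap_eq_sum_right {l1 l2 l12 l3 l123 l4 l : ℂ} {B T : ℕ}
    (hB : l12 + l3 + l4 - l = B) (hT : l1 + l2 + l3 + l4 - l = T) (hBT : B ≤ T)
    (H : HasRecoupling h hq D l12 l3 l123 l4 l)
    (H' : ∀ p ≤ B, HasRecoupling h hq D l1 l2 l12 (l3 + l4 - p) l) (x : VermaSpace) :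
    fourfoldMap hq D l1 l2 l12 l3 l123 l4 l x =
      ∑ k ∈ Finset.range (T + 1), TensorProduct.map LinearMap.id
        (∑ p ∈ Finset.range (min k B + 1),
          (q6j h hq D l12 l3 l123 l4 l (l3 + l4 - p) *
            q6j h hq D l1 l2 l12 (l3 + l4 - p) l (l2 + l3 + l4 - k)) •
          rightMap hq D l2 l3 l4 (l3 + l4 - p) (l2 + l3 + l4 - k))
        (psi h hq D l1 (l2 + l3 + l4 - k) l x) := by
  have step : ∀ p ≤ B, TensorProduct.assoc ℂ VermaSpace VermaSpace (VermaSpace ⊗[ℂ] VermaSpace)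
        (TensorProduct.map (psi h hq D l1 l2 l12) LinearMap.id
          (rightMap hq D l12 l3 l4 (l3 + l4 - p) l x)) =
      ∑ m ∈ Finset.range (T - p + 1),
        q6j h hq D l1 l2 l12 (l3 + l4 - p) l (l2 + l3 + l4 - (p + m : ℕ)) •
          TensorProduct.map LinearMap.id
            (rightMap hq D l2 l3 l4 (l3 + l4 - p) (l2 + l3 + l4 - (p + m : ℕ)))
            (psi h hq D l1 (l2 + l3 + l4 - (p + m : ℕ)) l x) := by
    intro p hp
    have e := LinearMap.congr_fun (leftMap_eq_sum_q6j hq (H' p hp) (N := T - p) (by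
      rw [Nat.cast_sub (hp.trans hBT), ← hT]; ring)) x
    have e1 : TensorProduct.map (psi h hq D l1 l2 l12) LinearMap.id
          (rightMap hq D l12 l3 l4 (l3 + l4 - p) l x) =
        TensorProduct.map LinearMap.id (psi h hq D l3 l4 (l3 + l4 - p))
          (TensorProduct.map (psi h hq D l1 l2 l12) LinearMap.id
            (psi h hq D l12 (l3 + l4 - p) l x)) := by
      rw [rightMap, LinearMap.comp_apply, TensorProduct.map_map, TensorProduct.map_map]
      rfl
    rw [e1, assoc_map_right]
    change TensorProduct.map LinearMap.id _ (leftMap hq D l1 l2 l12 (l3 + l4 - p) l x) = _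
    rw [e, LinearMap.sum_apply, map_sum]
    refine Finset.sum_congr rfl fun m _ => ?_
    have em : l2 + l3 + l4 - (p + m : ℕ) = l2 + (l3 + l4 - p) - m := by push_cast; ring
    rw [em, LinearMap.smul_apply, map_smul, rightMap, LinearMap.comp_apply,
      TensorProduct.map_map]
    rfl
  have e0 : fourfoldMap hq D l1 l2 l12 l3 l123 l4 l x =
      TensorProduct.assoc ℂ VermaSpace VermaSpace (VermaSpace ⊗[ℂ] VermaSpace)
        (TensorProduct.map (psi h hq D l1 l2 l12) LinearMap.id
          (leftMap hq D l12 l3 l123 l4 l x)) := by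
    -- The pentagon for associators replaces the rebracketing built into `fourfoldMap` by one that
    -- treats 12 as a single factor until the end.
    have e1 : TensorProduct.map (leftMap hq D l1 l2 l12 l3 l123) LinearMap.id
          (psi h hq D l123 l4 l x) =
        TensorProduct.map (TensorProduct.assoc ℂ VermaSpace VermaSpace VermaSpace).toLinearMap
          LinearMap.id (TensorProduct.map
            (TensorProduct.map (psi h hq D l1 l2 l12) LinearMap.id) LinearMap.id
            (TensorProduct.map (psi h hq D l12 l3 l123) LinearMap.id
              (psi h hq D l123 l4 l x))) := by
      rw [TensorProduct.map_map, TensorProduct.map_map]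
      rfl
    change TensorProduct.map LinearMap.id _ (TensorProduct.assoc ℂ _ _ _
      (TensorProduct.map (leftMap hq D l1 l2 l12 l3 l123) LinearMap.id
          (psi h hq D l123 l4 l x))) = _
    rw [e1, assoc_pentagon, assoc_map_left]
    rfl
  rw [e0, leftMap_eq_sum_q6j hq H hB]
  have e2 := sum_range_sum_range_add hBT fun p k =>
    (q6j h hq D l12 l3 l123 l4 l (l3 + l4 - p) *
      q6j h hq D l1 l2 l12 (l3 + l4 - p) l (l2 + l3 + l4 - k)) •
        TensorProduct.map LinearMap.id (rightMap hq D l2 l3 l4 (l3 + l4 - p) (l2 + l3 + l4 - k))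
          (psi h hq D l1 (l2 + l3 + l4 - k) l x)
  rw [LinearMap.sum_apply, map_sum, map_sum]
  refine (Finset.sum_congr rfl fun p hp => ?_).trans (e2.trans (Finset.sum_congr rfl fun k _ => ?_))
  · rw [LinearMap.smul_apply, map_smul, map_smul,
      step p (Nat.lt_succ_iff.mp (Finset.mem_range.mp hp)), Finset.smul_sum]
    simp only [smul_smul]
  · simp only [← TensorProduct.mapBilinear_apply, map_sum, map_smul, LinearMap.sum_apply,
      LinearMap.smul_apply]

end Pentagon

end VermaSixJ

/-! ### The pentagon identity -/

theorem mainTheorem4 (h : ℂ) (hq : NotRootOfUnity h)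
    (D : ℂ → ℂ → ℂ → ℂ) (hD : IsDelta h D)
    (l1 l2 l3 l4 l12 l34 l123 l234 l1234 : ℂ)
    (g1 : Generic h l1) (g2 : Generic h l2) (g3 : Generic h l3) (g4 : Generic h l4)
    (g12 : Generic h l12) (g23 : Generic h (l2 + l3)) (g34 : Generic h l34)
    (g123 : Generic h l123) (g234 : Generic h l234) (g1234 : Generic h l1234)
    (n12 : IsNat (l1 + l2 - l12)) (n34 : IsNat (l3 + l4 - l34))
    (n12_3 : IsNat (l12 + l3 - l123)) (n2_34 : IsNat (l2 + l34 - l234))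
    (n123_4 : IsNat (l123 + l4 - l1234)) (n1_234 : IsNat (l1 + l234 - l1234))
    (n12_34 : IsNat (l12 + l34 - l1234)) :
    -- the expansions that define the symbols below exist and are unique
    (∀ j ≤ min (toN (l2 + l3 + l4 - l234)) (toN (l1 + l2 + l3 - l123)),
      HasRecoupling h hq D l1 (l2 + l3 - j) l123 l4 l1234 ∧
      HasRecoupling h hq D l2 l3 (l2 + l3 - j) l4 l234) ∧
    HasRecoupling h hq D l1 l2 l12 l3 l123 ∧
    HasRecoupling h hq D l12 l3 l123 l4 l1234 ∧
    HasRecoupling h hq D l1 l2 l12 l34 l1234 ∧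
    -- the pentagon identity
    ∑ j ∈ Finset.range (min (toN (l2 + l3 + l4 - l234)) (toN (l1 + l2 + l3 - l123)) + 1),
      q6j h hq D l1 l2 l12 l3 l123 (l2 + l3 - j) *
      q6j h hq D l1 (l2 + l3 - j) l123 l4 l1234 l234 *
      q6j h hq D l2 l3 (l2 + l3 - j) l4 l234 l34 =
    q6j h hq D l12 l3 l123 l4 l1234 l34 *
      q6j h hq D l1 l2 l12 l34 l1234 l234 := by
  have N12 := n12
  have N12_3 := n12_3
  have N123_4 := n123_4
  obtain ⟨a, ha⟩ := n12
  obtain ⟨p, hp⟩ := n34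
  obtain ⟨b, hb⟩ := n12_3
  obtain ⟨r, hr⟩ := n2_34
  obtain ⟨s, hs⟩ := n123_4
  obtain ⟨t, ht⟩ := n1_234
  obtain ⟨u, hu⟩ := n12_34
  have hT1 : l1 + l2 + l3 + l4 - l1234 = (p + r + t : ℕ) := by
    push_cast; linear_combination hp + hr + ht
  have hT2 : l1 + l2 + l3 + l4 - l1234 = (a + b + s : ℕ) := by
    push_cast; linear_combination ha + hb + hs
  have hB1 : l12 + l3 + l4 - l1234 = (b + s : ℕ) := by push_cast; linear_combination hb + hs
  have hB2 : l12 + l3 + l4 - l1234 = (p + u : ℕ) := by push_cast; linear_combination hp + hu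
  -- The two counts of each total drop in weight give a + b ≤ T, p + r ≤ T and p ≤ b + s, with T = a
  -- + b + s; these keep all indices in range.
  have eT : p + r + t = a + b + s := by exact_mod_cast hT1.symm.trans hT2
  have eB : b + s = p + u := by exact_mod_cast hB1.symm.trans hB2
  have hA : l1 + l2 + l3 - l123 = (a + b : ℕ) := by push_cast; linear_combination ha + hb
  have hP : l2 + l3 + l4 - l234 = (p + r : ℕ) := by push_cast; linear_combination hp + hr
  have e34 : l3 + l4 - p = l34 := by rw [← hp]; ring
  have e234 : l2 + l3 + l4 - (p + r : ℕ) = l234 := by rw [← hP]; ring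
  -- Genericity is invariant under integer shifts, so it passes from `l34` and `l234` to the
  -- unlowered sums. For l2 + l3 no intermediate weight is given, so its genericity is assumed.
  have g3_4 : Generic h (l3 + l4) := by
    rw [show l3 + l4 = l34 + p by rw [← hp]; ring]; exact g34.add_natCast p
  have g2_3_4 : Generic h (l2 + l3 + l4) := by
    rw [show l2 + l3 + l4 = l234 + (p + r : ℕ) by rw [← hP]; ring]; exact g234.add_natCast _
  have g2_34 : ∀ k : ℕ, Generic h (l2 + (l3 + l4 - k)) := fun k => by
    rw [show l2 + (l3 + l4 - k) = l2 + l3 + l4 - k by ring]; exact g2_3_4.sub_natCast k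
  have g23_4 : ∀ k : ℕ, Generic h (l2 + l3 - k + l4) := fun k => by
    rw [show l2 + l3 - k + l4 = l2 + l3 + l4 - k by ring]; exact g2_3_4.sub_natCast k
  have H1 : HasRecoupling h hq D l1 l2 l12 l3 l123 :=
    hasRecoupling hq hD g1 g2 g3 g12 g23 g123 N12 N12_3
  have H2 : ∀ j ≤ a + b, HasRecoupling h hq D l1 (l2 + l3 - j) l123 l4 l1234 := fun j hj =>
    hasRecoupling hq hD g1 (g23.sub_natCast j) g4 g123 (g23_4 j) g1234
      ⟨a + b - j, by rw [Nat.cast_sub hj, ← hA]; ring⟩ N123_4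
  have H3 : ∀ j ≤ p + r, HasRecoupling h hq D l2 l3 (l2 + l3 - j) l4 l234 := fun j hj =>
    hasRecoupling hq hD g2 g3 g4 (g23.sub_natCast j) g3_4 g234 ⟨j, by ring⟩
      ⟨p + r - j, by rw [Nat.cast_sub hj, ← hP]; ring⟩
  have H4 : HasRecoupling h hq D l12 l3 l123 l4 l1234 :=
    hasRecoupling hq hD g12 g3 g4 g123 g3_4 g1234 N12_3 N123_4
  have H5 : ∀ k ≤ b + s, HasRecoupling h hq D l1 l2 l12 (l3 + l4 - k) l1234 := fun k hk =>
    hasRecoupling hq hD g1 g2 (g3_4.sub_natCast k) g12 (g2_34 k) g1234 N12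
      ⟨b + s - k, by rw [Nat.cast_sub hk, ← hB1]; ring⟩
  rw [hP, hA, toN_natCast, toN_natCast]
  refine ⟨fun j hj => ⟨H2 j (hj.trans (min_le_right _ _)), H3 j (hj.trans (min_le_left _ _))⟩,
    H1, H4, by simpa only [e34] using H5 p (by omega), ?_⟩
  have e := (fourfoldMap_eq_sum_left hq D hA hT2 (by omega) H1 H2 (vec 0)).symm.trans
    (fourfoldMap_eq_sum_right hq D hB1 hT2 (by omega) H4 H5 (vec 0))
  -- Index k = p + r picks out the summand through `M_l234`; there the range min k (a + b) is
  -- exactly that of the theorem.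
  have e' := hom_eq_of_sum_map_psi_eq hq hD g1 g2_3_4 g1234
    (B := (verma h hq l2).tensor ((verma h hq l3).tensor (verma h hq l4)))
    (by rw [← hT2]; ring) (fun k _ => UqModule.IsHom.sum fun j hj => UqModule.IsHom.smul ?_ _)
    (fun k _ => UqModule.IsHom.sum fun j hj => UqModule.IsHom.smul ?_ _) e (p + r) (by omega)
  · rw [e234] at e'
    have e3 : ∀ j ≤ p + r, leftMap hq D l2 l3 (l2 + l3 - j) l4 l234 =
        ∑ m ∈ Finset.range (p + r + 1), q6j h hq D l2 l3 (l2 + l3 - j) l4 l234 (l3 + l4 - m) •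
          rightMap hq D l2 l3 l4 (l3 + l4 - m) l234 := fun j hj =>
      leftMap_eq_sum_q6j hq (H3 j hj) hP
    have e4 := expansion_unique hq hD g2 g3 g4 g3_4 g234 hP
      (c := fun m => ∑ j ∈ Finset.range (min (p + r) (a + b) + 1),
        q6j h hq D l1 l2 l12 l3 l123 (l2 + l3 - j) *
        q6j h hq D l1 (l2 + l3 - j) l123 l4 l1234 l234 *
        q6j h hq D l2 l3 (l2 + l3 - j) l4 l234 (l3 + l4 - m))
      -- The right expansion only runs to min (p + r) (b + s), so it is padded with zeros up to p +
      -- r. The identity is the coefficient at m = p, where l3 + l4 - m = l34.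
      (c' := fun m => if m ≤ b + s then q6j h hq D l12 l3 l123 l4 l1234 (l3 + l4 - m) *
        q6j h hq D l1 l2 l12 (l3 + l4 - m) l1234 l234 else 0) ?_ p (by omega)
    · simpa only [e34, if_pos (show p ≤ b + s by omega)] using e4
    · simp only [Finset.sum_smul]
      rw [Finset.sum_comm]
      refine Eq.trans (Finset.sum_congr rfl fun j hj => ?_) (e'.trans ?_)
      · have := Finset.mem_range.mp hj
        rw [e3 j (by omega), Finset.smul_sum]
        simp only [smul_smul]
      · simp only [ite_smul, zero_smul]
        rw [← Finset.sum_filter]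
        refine Finset.sum_congr (Finset.ext fun m => ?_) fun _ _ => rfl
        simp only [Finset.mem_filter, Finset.mem_range]
        omega
  · have hj : j ≤ k := by have := Finset.mem_range.mp hj; omega
    exact leftMap_isHom hq D (g23.sub_natCast j) (g2_3_4.sub_natCast k) (n := j) (m := k - j)
      (by ring) (by rw [Nat.cast_sub hj]; ring)
  · have hj : j ≤ k := by have := Finset.mem_range.mp hj; omega
    exact rightMap_isHom hq D (g3_4.sub_natCast j) (g2_3_4.sub_natCast k) (n := j) (m := k - j)
      (by ring) (by rw [Nat.cast_sub hj]; ring)
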